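/- **Setting.** Let $\mathcal N$ be a finite directed graph without loops, parallel arcs or opposite arcs. Every arc $vw$ has a capacity $u_{vw}\in\mathbb R_{>0}\cup\{\infty\}$ and a transit time $\tau_{vw}\in\mathbb R_{\ge 0}$. There are disjoint sets $S^+$ of sources, with no incoming arcs, and $S^-$ of sinks, with no outgoing arcs. For each arc $vw$ a reverse arc $wv$ is added, with $u_{wv}=0$ and $\tau_{wv}=-\tau_{vw}$. Let $\theta\in\mathbb R_{\ge 0}$. The *extended network* $\mathcal N_{S^+}$ arises from $\mathcal N$ by adding a super-source $\psi$, arcs $\psi s$ for all $s\in S^+$ with $u_{\psi s}=\infty$ and $\tau_{\psi s}=0$, and arcs $t\psi$ for all $t\in S^-$ with $u_{t\psi}=\infty$ and $\tau_{t\psi}=-\theta$ (and their reverse arcs). A *circulation* $x$ assigns to the arcs real values with $x_{wv}=-x_{vw}$ and $\sum_w x_{vw}=0$ at every node $v$. It is *feasible* if $x_{vw}\le u_{vw}$ on all arcs. Its cost is $c(x)=\sum_{\{v,w\}}\tau_{vw}x_{vw}$, with one arc taken from each pair of opposite arcs. A minimum-cost circulation is a feasible circulation of minimum cost. A *flow over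 time* $f$ in $\mathcal N$ consists of Lebesgue integrable functions $f_{vw}:\mathbb R\to\mathbb R$, one for each arc, with $f_{wv}(t)=-f_{vw}(t-\tau_{vw})$ for all $t$, and with $\sum_w f_{vw}(t)=0$ for all $t$ and all nodes $v\notin S^+\cup S^-$. It is *feasible* if $f_{vw}(t)\le u_{vw}$ for all arcs and all $t$, and it has *time horizon* $\theta$ if $f_{vw}(t)=0$ for all arcs and all $t\notin[0,\theta)$. For a flow over time with time horizon $\theta$, the amount of flow sent from $S^+$ to $S^-$ is $\sum_{s\in S^+}\sum_w\int f_{sw}(t)\,dt$. A *standard chain decomposition* of a circulation $y$ in $\mathcal N_{S^+}$ is a finite multiset $\Gamma$ of chain flows $\gamma$, each sending $|\gamma|>0$ units along a simple cycle $C_\gamma$, which sum to $y$, such that every $C_\gamma$ uses only arcs $a$ with $y_a>0$. If every $C_\gamma$ contains an arc from $\psi$ to a source, let $P_\gamma$ be the source-sink path obtained from $C_\gamma$ by deleting $\psi$. The *temporally repeated flow* $[\Gamma]^\theta$ is the flow over time that sends flow at rate $|\gamma|$ into $P_\gamma$ during $[0,\theta-\tau(P_\gamma))$, for every $\gamma\in\Gamma$.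 **Theorem (Ford–Fulkerson; Anderson–Philpott).** Let $x$ be a minimum-cost circulation in $\mathcal N_{S^+}$. Then the maximum amount of flow that a feasible flow over time with time horizon $\theta$ can send from $S^+$ to $S^-$ exists and is equal to $-c(x)$. The maximum is attained by a temporally repeated flow: there are a minimum-cost circulation $y$ in $\mathcal N_{S^+}$ and a standard chain decomposition $\Gamma$ of $y$, all of whose cycles contain an arc from $\psi$ to a source, such that $[\Gamma]^\theta$ is a feasible flow over time with time horizon $\theta$ that sends exactly $-c(x)$ units of flow from $S^+$ to $S^-$. Moreover, a minimum-cost circulation in $\mathcal N_{S^+}$ exists if and only if the amounts of flow sent from $S^+$ to $S^-$ by feasible flows over time with time horizon $\theta$ are bounded above; in particular, it exists if all capacities of original arcs of $\mathcal N$ are finite. -/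

import Mathlib

open MeasureTheory

noncomputable section

namespace FlowOverTime

/-- A directed graph on the node set `V` with arc capacities in `(0, ∞]` and real transit times
(also called lengths or costs). There are no loops, no parallel arcs and no opposite arcs.
`Arc v w` says that `vw` is an original arc. For every original arc `vw` the reverse arc `wv` is
added, with capacity `0` and transit time `-transit v w`. The values of `cap` and `transit` at
pairs that are neither original nor reverse arcs play no role. -/
structure ArcNet (V : Type*) where
  Arc : V → V → Prop
  cap : V → V → EReal
  transit : V → V → ℝ
  asymm : ∀ v w, Arc v w → ¬ Arc w v
  cap_pos : ∀ v w, Arc v w → 0 < cap v w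
  cap_rev : ∀ v w, Arc v w → cap w v = 0
  transit_rev : ∀ v w, Arc v w → transit w v = -transit v w

namespace ArcNet

variable {V : Type*} (M : ArcNet V)

/-- `vw` belongs to the arc set that contains the original arcs and their reverse arcs. -/
def IsArc (v w : V) : Prop := M.Arc v w ∨ M.Arc w v

/-- A static circulation: a skew-symmetric assignment of values to the arcs (with value `0` at
pairs that are not arcs) with flow conservation at every node. -/
structure IsCirculation [Fintype V] (x : V → V → ℝ) : Prop where
  skew : ∀ v w, x w v = -x v w
  off_arc : ∀ v w, ¬ M.IsArc v w → x v w = 0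
  conservation : ∀ v, ∑ w, x v w = 0

/-- The capacity constraints; the one at a reverse arc says that the flow on the original arc
is non-negative. -/
def IsFeasible (x : V → V → ℝ) : Prop :=
  ∀ v w, M.IsArc v w → (x v w : EReal) ≤ M.cap v w

open Classical in
/-- The cost `∑ transit v w * x v w`, where one arc is taken from each pair of opposite arcs,
namely the original one. -/
def cost [Fintype V] (x : V → V → ℝ) : ℝ :=
  ∑ v, ∑ w, if M.Arc v w then M.transit v w * x v w else 0

/-- `x` is a feasible circulation of minimum cost. -/
def IsMinCostCirculation [Fintype V] (x : V → V → ℝ) : Prop :=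
  M.IsCirculation x ∧ M.IsFeasible x ∧
    ∀ y, M.IsCirculation y → M.IsFeasible y → M.cost x ≤ M.cost y

end ArcNet

/-- The arcs `v₀v₁, …, vₖ₋₁vₖ` of the path with node list `v₀, …, vₖ`. -/
def pathArcs {V : Type*} (p : List V) : List (V × V) := p.zip p.tail

/-- The arcs `v₀v₁, …, vₖ₋₁vₖ, vₖv₀` of the cycle with node list `v₀, …, vₖ`. -/
def cycleArcs {V : Type*} (c : List V) : List (V × V) := c.zip (c.rotate 1)

/-- A chain flow along a (simple) cycle: the cycle is given by the list of its nodes, starting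
anywhere, and `value` units of flow are sent along it. -/
structure CycleFlow {V : Type*} (M : ArcNet V) where
  nodes : List V
  ne_nil : nodes ≠ []
  nodup : nodes.Nodup
  isArc : ∀ a ∈ cycleArcs nodes, M.IsArc a.1 a.2
  value : ℝ
  value_pos : 0 < value

/-- The static flow given by a chain flow. -/
def CycleFlow.flow {V : Type*} [DecidableEq V] {M : ArcNet V} (γ : CycleFlow M) (v w : V) : ℝ :=
  (if (v, w) ∈ cycleArcs γ.nodes then γ.value else 0) -
    (if (w, v) ∈ cycleArcs γ.nodes then γ.value else 0)

/-- `Γ` is a standard chain decomposition of `x` into flows along cycles: the chain flows add up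
to `x`, and each of them uses arcs only in the direction in which `x` uses them. -/
def IsStandardChainDecomposition {V : Type*} [DecidableEq V] {M : ArcNet V}
    (Γ : Multiset (CycleFlow M)) (x : V → V → ℝ) : Prop :=
  (∀ v w, (Γ.map fun γ => γ.flow v w).sum = x v w) ∧
    ∀ γ ∈ Γ, ∀ a ∈ cycleArcs γ.nodes, 0 < x a.1 a.2

/-- A network with sources and sinks (together: the terminals). Original arcs have non-negative
transit times, no original arc enters a source, and none leaves a sink. -/
structure Network (V : Type*) extends ArcNet V where
  sources : Finset V
  sinks : Finset V
  disjoint : Disjoint sources sinks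
  transit_nonneg : ∀ v w, Arc v w → 0 ≤ transit v w
  no_arc_into_source : ∀ v, ∀ s ∈ sources, ¬ Arc v s
  no_arc_from_sink : ∀ t ∈ sinks, ∀ w, ¬ Arc t w

namespace Network

variable {V : Type*} (N : Network V)

/-- The extended network for time horizon `θ` and a set `X` of terminals. The new node `none` is
the super-source. It has arcs of infinite capacity and transit time `0` to all sources in `X`,
and there are arcs of infinite capacity and transit time `-θ` to it from all sinks not in `X`. -/
def extended [DecidableEq V] (θ : ℝ) (X : Finset V) : ArcNet (Option V) where
  Arc
    | some v, some w => N.Arc v w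
    | none, some s => s ∈ N.sources ∧ s ∈ X
    | some t, none => t ∈ N.sinks ∧ t ∉ X
    | none, none => False
  cap
    | some v, some w => N.cap v w
    | none, some s => if s ∈ N.sources ∧ s ∈ X then ⊤ else 0
    | some t, none => if t ∈ N.sinks ∧ t ∉ X then ⊤ else 0
    | none, none => 0
  transit
    | some v, some w => N.transit v w
    | none, some t => if t ∈ N.sinks ∧ t ∉ X then θ else 0
    | some t, none => if t ∈ N.sinks ∧ t ∉ X then -θ else 0
    | none, none => 0
  asymm := by
    rintro (_ | v) (_ | w) h
    · exact h.elim
    · exact fun h' => h'.2 h.2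
    · exact fun h' => h.2 h'.2
    · exact N.asymm v w h
  cap_pos := by
    rintro (_ | v) (_ | w) h
    · exact h.elim
    · simp [h.1, h.2]
    · simp [h.1, h.2]
    · exact N.cap_pos v w h
  cap_rev := by
    rintro (_ | v) (_ | w) h
    · exact h.elim
    · simp [h.2]
    · simp [h.2]
    · exact N.cap_rev v w h
  transit_rev := by
    rintro (_ | v) (_ | w) h
    · exact h.elim
    · simp [h.2]
    · simp [h.1, h.2]
    · exact N.transit_rev v w h

/-- A flow over time: `f v w t` is the rate at which flow enters the arc `vw` at time `t`. The
rates are Lebesgue integrable functions of time; what enters `vw` at time `t` leaves it at time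
`t + transit v w`; flow is conserved at all times at every node that is not a terminal. -/
structure IsFlowOverTime [Fintype V] (f : V → V → ℝ → ℝ) : Prop where
  integrable : ∀ v w, Integrable (f v w)
  off_arc : ∀ v w, ¬ N.IsArc v w → ∀ t, f v w t = 0
  skew : ∀ v w, N.IsArc v w → ∀ t, f w v t = -f v w (t - N.transit v w)
  conservation : ∀ v, v ∉ N.sources → v ∉ N.sinks → ∀ t, ∑ w, f v w t = 0

/-- The capacity constraints for flows over time. -/
def IsFeasibleOverTime (f : V → V → ℝ → ℝ) : Prop :=
  ∀ v w, N.IsArc v w → ∀ t, (f v w t : EReal) ≤ N.cap v w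

/-- `f` has time horizon `θ`: the flow rates on all arcs (reverse arcs included, so that no flow
arrives at or after time `θ`) vanish outside `[0, θ)`. -/
def HasTimeHorizon (f : V → V → ℝ → ℝ) (θ : ℝ) : Prop :=
  ∀ v w, N.IsArc v w → ∀ t ∉ Set.Ico 0 θ, f v w t = 0

/-- The total amount of flow leaving the sources. For a flow over time with a time horizon it is
equal, by flow conservation, to the total amount of flow arriving at the sinks. -/
def amount [Fintype V] (f : V → V → ℝ → ℝ) : ℝ :=
  ∑ s ∈ N.sources, ∑ w, ∫ t, f s w t

/-- The set of all amounts of flow that feasible flows over time with time horizon `θ` send from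
the sources to the sinks. -/
def amounts [Fintype V] (θ : ℝ) : Set ℝ :=
  {F | ∃ f, N.IsFlowOverTime f ∧ N.IsFeasibleOverTime f ∧ N.HasTimeHorizon f θ ∧ N.amount f = F}

/-- The transit time of a path given by its list of nodes. -/
def pathTransit (p : List V) : ℝ := ((pathArcs p).map fun a => N.transit a.1 a.2).sum

variable [DecidableEq V]

/-- The path obtained from the cycle of a chain flow `γ` in an extended network by deleting the
super-source and its incident arcs; it starts at the node behind the super-source. -/
def sourceSinkPath {θ : ℝ} {X : Finset V} (γ : CycleFlow (N.extended θ X)) : List V :=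
  (γ.nodes.rotate (γ.nodes.idxOf none)).reduceOption

/-- The cycle of `γ` contains the arc from the super-source to some source. -/
def ThroughSuperSource {θ : ℝ} {X : Finset V} (γ : CycleFlow (N.extended θ X)) : Prop :=
  ∃ r ∈ N.sources, (none, some r) ∈ cycleArcs γ.nodes

/-- Flow at rate `r` is sent into the simple path `p` during the time interval
`[0, θ - pathTransit p)`: the rate at which it enters the arc `vw` at time `t`. It reaches the
node `v` of `p` with a delay equal to the length of the initial segment of `p` ending at `v`. -/
def pathRate (θ : ℝ) (p : List V) (r : ℝ) (v w : V) (t : ℝ) : ℝ :=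
  open Classical in
  if (v, w) ∈ pathArcs p ∧
      t - N.pathTransit (p.take (p.idxOf v + 1)) ∈ Set.Ico 0 (θ - N.pathTransit p)
    then r else 0

/-- The flow over time that sends flow at rate `γ.value` into the path of `γ` during the interval
`[0, θ - pathTransit)`, for every `γ ∈ Γ`. The second term is the flow entering the opposite arc
`wv`, counted negatively at the time of its arrival at `v`. -/
def temporallyRepeated {θ : ℝ} {X : Finset V} (Γ : Multiset (CycleFlow (N.extended θ X)))
    (v w : V) (t : ℝ) : ℝ :=
  (Γ.map fun γ =>
    N.pathRate θ (N.sourceSinkPath γ) γ.value v w t -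
      N.pathRate θ (N.sourceSinkPath γ) γ.value w v (t - N.transit w v)).sum

end Network

end FlowOverTime

end

/-!
The cycles of a chain decomposition of a circulation in the extended network and the source-sink
paths along which flow over time can be sent correspond to each other: a cycle through the
super-source with path `p` has cost `pathTransit p - θ`, and sending flow at unit rate into `p`
during `[0, θ - pathTransit p)` delivers exactly the negative of that cost.

*Attainment.* Every circulation `x` has a standard chain decomposition
(`ArcNet.IsCirculation.exists_decomposition`). If `x` has minimum cost, then cycles of non-negative
cost can be dropped without losing feasibility or optimality
(`ArcNet.IsMinCostCirculation.exists_negative_decomposition`). The remaining cycles pass through the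
super-source, as only arcs into it have negative transit time, and the temporally repeated flow of
their paths is feasible and has the amount `-cost x` (`Network.temporallyRepeated_of_cycleCost_neg`,
`Network.isFeasibleOverTime_temporallyRepeated`).

*Upper bound.* The residual network of a minimum-cost circulation has no negative cycle, so it
admits node potentials `p` (`exists_potential`), normalized to be `0` at the super-source. The arcs
of infinite capacity force `p ≤ 0` on the sources and `θ ≤ p` on the sinks. Hence the amount of a
flow over time `f` is the flow across the cut over time in which a node `v` changes to the source
side at time `p v`; an arc `vw` contributes the integral of `f v w` from `p v` to
`p w - transit v w`, which by complementary slackness is at most the negative of its reduced cost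
times `x v w`. These numbers add up to `-cost x` (`Network.amount_le`).

*Existence.* If every cycle of infinite capacity has non-negative cost, then such cycles can be
dropped from any circulation, and the rest is bounded by the sum of the finite capacities, so a
minimum exists by compactness (`ArcNet.exists_isMinCostCirculation`). A cycle of infinite capacity
and negative cost would make the amounts unbounded (`Network.cycleCost_nonneg_of_bddAbove`), and
there is no cycle of infinite capacity if the arcs of the original network have finite capacities
(`Network.exists_cap_ne_top`).
-/

noncomputable section

namespace FlowOverTime

/-! ### Cycles and flows along cycles -/

/-- On a simple cycle the successor of a node is its image under the cyclic permutation of the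
node list. -/
theorem mem_cycleArcs_iff {W : Type*} [DecidableEq W] {c : List W} (hc : c.Nodup) {v w : W} :
    (v, w) ∈ cycleArcs c ↔ v ∈ c ∧ c.formPerm v = w := by
  unfold cycleArcs
  rw [List.mem_iff_getElem]
  constructor
  · rintro ⟨i, hi, h⟩
    have hi' : i < c.length := by simpa using hi
    rw [List.getElem_zip, Prod.mk.injEq, List.getElem_rotate] at h
    obtain ⟨rfl, rfl⟩ := h
    exact ⟨List.getElem_mem _, List.formPerm_apply_getElem c hc i hi'⟩
  · rintro ⟨hv, rfl⟩
    obtain ⟨i, hi, rfl⟩ := List.mem_iff_getElem.1 hv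
    refine ⟨i, by simpa using hi, ?_⟩
    rw [List.getElem_zip, List.getElem_rotate, List.formPerm_apply_getElem c hc i hi]

theorem nodup_cycleArcs {W : Type*} {c : List W} (hc : c.Nodup) : (cycleArcs c).Nodup := by
  refine List.Nodup.of_map Prod.fst ?_
  unfold cycleArcs
  rw [List.map_fst_zip (by simp)]
  exact hc

theorem sum_cycleArcs_out {W : Type*} [Fintype W] [DecidableEq W] {c : List W} (hc : c.Nodup)
    (r : ℝ) (v : W) :
    (∑ w, if (v, w) ∈ cycleArcs c then r else 0) = if v ∈ c then r else 0 := by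
  simp only [mem_cycleArcs_iff hc]
  by_cases hv : v ∈ c <;> simp [hv]

theorem sum_cycleArcs_in {W : Type*} [Fintype W] [DecidableEq W] {c : List W} (hc : c.Nodup)
    (r : ℝ) (v : W) :
    (∑ w, if (w, v) ∈ cycleArcs c then r else 0) = if v ∈ c then r else 0 := by
  have h : ∀ w, (w, v) ∈ cycleArcs c ↔ v ∈ c ∧ c.formPerm.symm v = w := by
    intro w
    rw [mem_cycleArcs_iff hc, Equiv.symm_apply_eq]
    constructor
    · rintro ⟨h1, rfl⟩
      exact ⟨List.formPerm_apply_mem_of_mem h1, rfl⟩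
    · rintro ⟨h1, rfl⟩
      exact ⟨List.mem_of_formPerm_apply_mem h1, rfl⟩
  simp only [h]
  by_cases hv : v ∈ c <;> simp [hv]

theorem sum_map_cycleArcs {W : Type*} [Fintype W] [DecidableEq W] {c : List W} (hc : c.Nodup)
    (g : W → W → ℝ) :
    ((cycleArcs c).map fun a => g a.1 a.2).sum =
      ∑ v, ∑ w, if (v, w) ∈ cycleArcs c then g v w else 0 := by
  rw [← List.sum_toFinset (fun a : W × W => g a.1 a.2) (nodup_cycleArcs hc),
    ← Fintype.sum_prod_type' (fun v w => if (v, w) ∈ cycleArcs c then g v w else 0)]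
  simp [← List.mem_toFinset]

namespace ArcNet

variable {W : Type*} (M : ArcNet W)

theorem IsArc.symm {M : ArcNet W} {v w : W} (h : M.IsArc v w) : M.IsArc w v := Or.symm h

theorem transit_symm {M : ArcNet W} {v w : W} (h : M.IsArc v w) :
    M.transit w v = -M.transit v w := by
  rcases h with h | h
  · exact M.transit_rev v w h
  · rw [M.transit_rev w v h, neg_neg]

theorem cap_nonneg {M : ArcNet W} {v w : W} (h : M.IsArc v w) : 0 ≤ M.cap v w := by
  rcases h with h | h
  · exact (M.cap_pos v w h).le
  · exact (M.cap_rev w v h).ge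

theorem isFeasible_zero {M : ArcNet W} : M.IsFeasible (fun _ _ => 0) := fun _ _ h => by
  simpa using cap_nonneg h

/-- A sum over all ordered pairs of nodes, rearranged as a sum over the pairs of opposite arcs. -/
theorem sum_eq_sum_arcs [Fintype W] (g : W → W → ℝ) (hg : ∀ v w, ¬ M.IsArc v w → g v w = 0) :
    ∑ v, ∑ w, g v w =
      ∑ v, ∑ w, open Classical in if M.Arc v w then g v w + g w v else 0 := by
  classical
  have h : ∀ v w, g v w = (if M.Arc v w then g v w else 0) + (if M.Arc w v then g v w else 0) := by
    intro v w
    by_cases h1 : M.Arc v w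
    · simp [h1, M.asymm v w h1]
    · by_cases h2 : M.Arc w v
      · simp [h1, h2]
      · simp [h1, h2, hg v w (not_or.2 ⟨h1, h2⟩)]
  calc ∑ v, ∑ w, g v w
      = (∑ v, ∑ w, if M.Arc v w then g v w else 0) +
          ∑ v, ∑ w, if M.Arc w v then g v w else 0 := by
        simp only [← Finset.sum_add_distrib, ← h]
    _ = (∑ v, ∑ w, if M.Arc v w then g v w else 0) +
          ∑ v, ∑ w, if M.Arc v w then g w v else 0 := by
        rw [Finset.sum_comm (f := fun v w => if M.Arc w v then g v w else 0)]
    _ = _ := by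
        simp only [← Finset.sum_add_distrib]
        refine Finset.sum_congr rfl fun v _ => Finset.sum_congr rfl fun w _ => ?_
        split_ifs <;> simp

/-- The sum of the transit times of the arcs of a cycle. -/
def cycleCost (c : List W) : ℝ := ((cycleArcs c).map fun a => M.transit a.1 a.2).sum

variable {M} [Fintype W]

theorem IsCirculation.add {x y : W → W → ℝ} (hx : M.IsCirculation x) (hy : M.IsCirculation y) :
    M.IsCirculation (fun v w => x v w + y v w) where
  skew v w := by rw [hx.skew v w, hy.skew v w]; ring
  off_arc v w h := by rw [hx.off_arc v w h, hy.off_arc v w h, add_zero]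
  conservation v := by
    rw [Finset.sum_add_distrib, hx.conservation, hy.conservation, add_zero]

theorem IsCirculation.sub {x y : W → W → ℝ} (hx : M.IsCirculation x) (hy : M.IsCirculation y) :
    M.IsCirculation (fun v w => x v w - y v w) where
  skew v w := by rw [hx.skew v w, hy.skew v w]; ring
  off_arc v w h := by rw [hx.off_arc v w h, hy.off_arc v w h, sub_zero]
  conservation v := by
    rw [Finset.sum_sub_distrib, hx.conservation, hy.conservation, sub_zero]

theorem isCirculation_zero : M.IsCirculation (fun _ _ => 0) where
  skew v w := by simp
  off_arc v w h := rfl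
  conservation v := by simp

theorem cost_add (x y : W → W → ℝ) :
    M.cost (fun v w => x v w + y v w) = M.cost x + M.cost y := by
  unfold cost
  simp only [← Finset.sum_add_distrib]
  refine Finset.sum_congr rfl fun v _ => Finset.sum_congr rfl fun w _ => ?_
  split_ifs
  · ring
  · simp

theorem cost_zero : M.cost (fun _ _ => 0) = 0 := by simp [cost]

end ArcNet

namespace CycleFlow

variable {W : Type*} [DecidableEq W] {M : ArcNet W}

theorem flow_skew (γ : CycleFlow M) (v w : W) : γ.flow w v = -γ.flow v w := by
  unfold flow; ring

theorem flow_off_arc (γ : CycleFlow M) {v w : W} (h : ¬ M.IsArc v w) : γ.flow v w = 0 := by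
  unfold flow
  rw [if_neg fun h' => h (γ.isArc _ h'), if_neg fun h' => h (γ.isArc _ h').symm, sub_zero]

theorem isCirculation_flow [Fintype W] (γ : CycleFlow M) : M.IsCirculation γ.flow where
  skew := γ.flow_skew
  off_arc _ _ h := γ.flow_off_arc h
  conservation v := by
    unfold flow
    rw [Finset.sum_sub_distrib, sum_cycleArcs_out γ.nodup, sum_cycleArcs_in γ.nodup, sub_self]

theorem cost_flow [Fintype W] (γ : CycleFlow M) :
    M.cost γ.flow = γ.value * M.cycleCost γ.nodes := by
  classical
  have h := M.sum_eq_sum_arcs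
    (fun v w => if (v, w) ∈ cycleArcs γ.nodes then γ.value * M.transit v w else 0)
    (fun v w hvw => if_neg fun h' => hvw (γ.isArc _ h'))
  rw [ArcNet.cycleCost, sum_map_cycleArcs γ.nodup, Finset.mul_sum]
  simp only [Finset.mul_sum, mul_ite, mul_zero]
  rw [h]
  unfold ArcNet.cost flow
  refine Finset.sum_congr rfl fun v _ => Finset.sum_congr rfl fun w _ => ?_
  by_cases hvw : M.Arc v w
  · simp only [if_pos hvw]
    rw [M.transit_rev v w hvw]
    split_ifs <;> ring
  · simp only [if_neg hvw]

end CycleFlow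

/-- The sum of a family of chain flows. -/
def totalFlow {W : Type*} [DecidableEq W] {M : ArcNet W} (Γ : Multiset (CycleFlow M)) (v w : W) :
    ℝ :=
  (Γ.map fun γ => γ.flow v w).sum

section totalFlow

variable {W : Type*} [DecidableEq W] {M : ArcNet W}

theorem totalFlow_zero : totalFlow (0 : Multiset (CycleFlow M)) = fun _ _ => 0 := by
  funext v w; simp [totalFlow]

theorem totalFlow_cons (γ : CycleFlow M) (Γ : Multiset (CycleFlow M)) :
    totalFlow (γ ::ₘ Γ) = fun v w => γ.flow v w + totalFlow Γ v w := by
  funext v w; simp [totalFlow]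

theorem totalFlow_add (Γ Δ : Multiset (CycleFlow M)) :
    totalFlow (Γ + Δ) = fun v w => totalFlow Γ v w + totalFlow Δ v w := by
  funext v w; simp [totalFlow]

theorem isCirculation_totalFlow [Fintype W] (Γ : Multiset (CycleFlow M)) :
    M.IsCirculation (totalFlow Γ) := by
  induction Γ using Multiset.induction with
  | empty => rw [totalFlow_zero]; exact ArcNet.isCirculation_zero
  | cons γ Γ ih => rw [totalFlow_cons]; exact γ.isCirculation_flow.add ih

theorem cost_totalFlow [Fintype W] (Γ : Multiset (CycleFlow M)) :
    M.cost (totalFlow Γ) = (Γ.map fun γ => γ.value * M.cycleCost γ.nodes).sum := by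
  induction Γ using Multiset.induction with
  | empty => rw [totalFlow_zero]; exact ArcNet.cost_zero
  | cons γ Γ ih =>
    rw [totalFlow_cons, ArcNet.cost_add, ih, γ.cost_flow, Multiset.map_cons, Multiset.sum_cons]

end totalFlow

/-! ### Chain decompositions -/

/-- A self-map of a finite type has a simple cycle all of whose nodes are iterates of `v`. -/
theorem exists_cycle_of_iterate {W : Type*} [Finite W] (f : W → W) (v : W) :
    ∃ c : List W, c ≠ [] ∧ c.Nodup ∧ (∀ u ∈ c, ∃ n, u = f^[n] v) ∧
      ∀ a ∈ cycleArcs c, a.2 = f a.1 := by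
  classical
  obtain ⟨i, j, hij, h⟩ : ∃ i j : ℕ, i < j ∧ f^[i] v = f^[j] v := by
    obtain ⟨i, j, hne, h⟩ := Finite.exists_ne_map_eq_of_infinite fun n : ℕ => f^[n] v
    rcases hne.lt_or_gt with h' | h'
    · exact ⟨i, j, h', h⟩
    · exact ⟨j, i, h', h.symm⟩
  set u := f^[i] v with hu
  have hper : Function.IsPeriodicPt f (j - i) u := by
    have : f^[j] v = f^[j - i] u := by
      rw [hu, ← Function.iterate_add_apply, Nat.sub_add_cancel hij.le]
    exact this.symm.trans h.symm
  have hpos : 0 < Function.minimalPeriod f u := hper.minimalPeriod_pos (by omega)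
  have hnd : ((List.range (Function.minimalPeriod f u)).map fun n => f^[n] u).Nodup := by
    refine List.Nodup.map_on ?_ List.nodup_range
    intro m hm n hn hmn
    rw [List.mem_range] at hm hn
    exact (Function.iterate_eq_iterate_iff_of_lt_minimalPeriod hm hn).1 hmn
  refine ⟨(List.range (Function.minimalPeriod f u)).map fun n => f^[n] u, ?_, hnd, ?_, ?_⟩
  · simp [hpos.ne']
  · intro y hy
    obtain ⟨n, -, rfl⟩ := List.mem_map.1 hy
    exact ⟨n + i, by rw [Function.iterate_add_apply]⟩
  · rintro ⟨a, b⟩ hab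
    rw [mem_cycleArcs_iff hnd] at hab
    obtain ⟨ha, rfl⟩ := hab
    obtain ⟨n, hn, rfl⟩ := List.mem_iff_getElem.1 ha
    rw [List.formPerm_apply_getElem _ hnd]
    simp only [List.getElem_map, List.getElem_range, List.length_map, List.length_range]
    rw [Function.iterate_mod_minimalPeriod_eq, Function.iterate_succ_apply']

/-- Following arcs with positive flow, which is always possible by conservation, closes a simple
cycle. -/
theorem ArcNet.IsCirculation.exists_positive_cycle {W : Type*} [Fintype W]
    {M : ArcNet W} {x : W → W → ℝ} (hx : M.IsCirculation x) {v w : W} (h : 0 < x v w) :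
    ∃ c : List W, c ≠ [] ∧ c.Nodup ∧ ∀ a ∈ cycleArcs c, 0 < x a.1 a.2 := by
  classical
  have step : ∀ u, (∃ w, 0 < x u w) → ∃ w, 0 < x u w ∧ ∃ z, 0 < x w z := by
    rintro u ⟨w, huw⟩
    refine ⟨w, huw, ?_⟩
    by_contra! hz
    have hlt : ∑ z, x w z < ∑ _z : W, (0 : ℝ) :=
      Finset.sum_lt_sum (fun z _ => hz z) ⟨u, Finset.mem_univ _, by rw [hx.skew u w]; linarith⟩
    rw [hx.conservation] at hlt
    simp at hlt
  choose! f hf hf' using step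
  obtain ⟨c, hne, hnd, hmem, harc⟩ := exists_cycle_of_iterate f v
  have hiter : ∀ n, ∃ w, 0 < x (f^[n] v) w := by
    intro n
    induction n with
    | zero => exact ⟨w, h⟩
    | succ n ih => rw [Function.iterate_succ_apply']; exact hf' _ ih
  refine ⟨c, hne, hnd, fun a ha => ?_⟩
  obtain ⟨n, hn⟩ := hmem a.1 ((mem_cycleArcs_iff hnd).1 ha).1
  rw [harc a ha, hn]
  exact hf _ (hiter n)

theorem ArcNet.IsCirculation.exists_decomposition {W : Type*} [Fintype W] [DecidableEq W]
    {M : ArcNet W} {x : W → W → ℝ} (hx : M.IsCirculation x) :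
    ∃ Γ : Multiset (CycleFlow M), IsStandardChainDecomposition Γ x := by
  induction hn : (Finset.univ.filter fun a : W × W => 0 < x a.1 a.2).card
    using Nat.strong_induction_on generalizing x with
  | _ n ih =>
  subst hn
  by_cases hpos : ∃ v w, 0 < x v w
  swap
  · push Not at hpos
    have hzero : ∀ v w, x v w = 0 := fun v w =>
      le_antisymm (hpos v w) (by have := hpos w v; rw [hx.skew v w] at this; linarith)
    exact ⟨0, fun v w => by simp [hzero], fun γ hγ => by simp at hγ⟩
  obtain ⟨v, w, hvw⟩ := hpos
  obtain ⟨c, hne, hnd, hc⟩ := hx.exists_positive_cycle hvw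
  have hisArc : ∀ a ∈ cycleArcs c, M.IsArc a.1 a.2 := fun a ha => by
    by_contra h
    have := hc a ha
    rw [hx.off_arc _ _ h] at this
    exact this.false
  have hane : (cycleArcs c).toFinset.Nonempty := by
    obtain ⟨u, hu⟩ := List.exists_mem_of_ne_nil c hne
    exact ⟨(u, c.formPerm u), List.mem_toFinset.2 ((mem_cycleArcs_iff hnd).2 ⟨hu, rfl⟩)⟩
  obtain ⟨a₀, ha₀, hmin⟩ := Finset.exists_min_image _ (fun a : W × W => x a.1 a.2) hane
  rw [List.mem_toFinset] at ha₀
  -- Subtracting the bottleneck flow along the cycle leaves fewer arcs with positive flow.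
  let γ : CycleFlow M := ⟨c, hne, hnd, hisArc, x a₀.1 a₀.2, hc a₀ ha₀⟩
  have hγ : ∀ v w, γ.flow v w = (if (v, w) ∈ cycleArcs c then x a₀.1 a₀.2 else 0) -
    (if (w, v) ∈ cycleArcs c then x a₀.1 a₀.2 else 0) := fun _ _ => rfl
  have hopp : ∀ v w, (v, w) ∈ cycleArcs c → (w, v) ∉ cycleArcs c := fun v w h h' => by
    have h1 := hc _ h
    have h2 := hc _ h'
    simp only at h1 h2
    rw [hx.skew v w] at h2
    linarith
  have hsub : ∀ v w, 0 < x v w - γ.flow v w → 0 < x v w := by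
    intro v w h
    by_cases h1 : (v, w) ∈ cycleArcs c
    · exact hc _ h1
    by_cases h2 : (w, v) ∈ cycleArcs c
    · have h3 := hmin (w, v) (List.mem_toFinset.2 h2)
      simp only at h3
      rw [hγ, if_neg h1, if_pos h2] at h
      rw [hx.skew v w] at h3
      linarith
    · rwa [hγ, if_neg h1, if_neg h2, sub_zero, sub_zero] at h
  have hlt : (Finset.univ.filter fun a : W × W => 0 < x a.1 a.2 - γ.flow a.1 a.2).card <
      (Finset.univ.filter fun a : W × W => 0 < x a.1 a.2).card := by
    refine Finset.card_lt_card ⟨fun a ha => ?_, fun hle => ?_⟩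
    · rw [Finset.mem_filter] at ha ⊢
      exact ⟨ha.1, hsub _ _ ha.2⟩
    · have := hle (Finset.mem_filter.2 ⟨Finset.mem_univ a₀, hc a₀ ha₀⟩)
      rw [Finset.mem_filter, hγ, if_pos ha₀, if_neg (hopp _ _ ha₀)] at this
      linarith [this.2]
  obtain ⟨Γ, hΓ, hΓ'⟩ := ih _ hlt (hx.sub γ.isCirculation_flow) rfl
  refine ⟨γ ::ₘ Γ, fun v w => by simp [hΓ], fun δ hδ a ha => ?_⟩
  rcases Multiset.mem_cons.1 hδ with rfl | hδ
  · exact hc a ha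
  · exact hsub _ _ (hΓ' δ hδ a ha)

namespace IsStandardChainDecomposition

variable {W : Type*} [DecidableEq W] {M : ArcNet W} {Γ Γ' : Multiset (CycleFlow M)}
  {x : W → W → ℝ}

theorem totalFlow_eq (h : IsStandardChainDecomposition Γ x) : totalFlow Γ = x := by
  funext v w; exact h.1 v w

theorem flow_nonneg (h : IsStandardChainDecomposition Γ x) (hx : ∀ v w, x w v = -x v w)
    {γ : CycleFlow M} (hγ : γ ∈ Γ) {v w : W} (hvw : 0 ≤ x v w) : 0 ≤ γ.flow v w := by
  have h1 : (w, v) ∉ cycleArcs γ.nodes := fun h1 => by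
    have := h.2 γ hγ _ h1
    simp only [hx v w] at this
    linarith
  have := γ.value_pos
  rw [CycleFlow.flow, if_neg h1, sub_zero]
  split_ifs <;> linarith

theorem flow_eq (h : IsStandardChainDecomposition Γ x) (hx : ∀ v w, x w v = -x v w)
    {γ : CycleFlow M} (hγ : γ ∈ Γ) {v w : W} (hvw : 0 ≤ x v w) :
    γ.flow v w = if (v, w) ∈ cycleArcs γ.nodes then γ.value else 0 := by
  have h1 : (w, v) ∉ cycleArcs γ.nodes := fun h1 => by
    have := h.2 γ hγ _ h1
    simp only [hx v w] at this
    linarith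
  rw [CycleFlow.flow, if_neg h1, sub_zero]

theorem totalFlow_nonneg (h : IsStandardChainDecomposition Γ x) (hx : ∀ v w, x w v = -x v w)
    (hle : Γ' ≤ Γ) {v w : W} (hvw : 0 ≤ x v w) : 0 ≤ totalFlow Γ' v w := by
  refine Multiset.sum_nonneg fun r hr => ?_
  obtain ⟨γ, hγ, rfl⟩ := Multiset.mem_map.1 hr
  exact h.flow_nonneg hx (Multiset.mem_of_le hle hγ) hvw

theorem totalFlow_le (h : IsStandardChainDecomposition Γ x) (hx : ∀ v w, x w v = -x v w)
    (hle : Γ' ≤ Γ) {v w : W} (hvw : 0 ≤ x v w) : totalFlow Γ' v w ≤ x v w := by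
  obtain ⟨Δ, rfl⟩ := Multiset.le_iff_exists_add.1 hle
  have h1 := h.totalFlow_nonneg hx (Multiset.le_add_left Δ Γ') hvw
  have h2 := congrFun (congrFun h.totalFlow_eq v) w
  rw [totalFlow_add] at h2
  linarith

/-- A subfamily of a standard chain decomposition of a feasible circulation adds up to a feasible
circulation, because all chain flows use an arc in the same direction. -/
theorem isFeasible_totalFlow [Fintype W] (h : IsStandardChainDecomposition Γ x)
    (hx : M.IsCirculation x) (hf : M.IsFeasible x) (hle : Γ' ≤ Γ) :
    M.IsFeasible (totalFlow Γ') := by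
  intro v w hvw
  rcases le_total 0 (x v w) with h0 | h0
  · exact (EReal.coe_le_coe_iff.2 (h.totalFlow_le hx.skew hle h0)).trans (hf v w hvw)
  · have h1 := h.totalFlow_nonneg hx.skew hle (v := w) (w := v) (by rw [hx.skew v w]; linarith)
    rw [(isCirculation_totalFlow Γ').skew v w] at h1
    exact (EReal.coe_le_coe_iff.2 (by linarith : totalFlow Γ' v w ≤ 0)).trans
      (ArcNet.cap_nonneg hvw)

theorem mono [Fintype W] (h : IsStandardChainDecomposition Γ x) (hx : M.IsCirculation x)
    (hle : Γ' ≤ Γ) : IsStandardChainDecomposition Γ' (totalFlow Γ') := by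
  refine ⟨fun _ _ => rfl, fun γ hγ a ha => ?_⟩
  have hγΓ := Multiset.mem_of_le hle hγ
  have hpos := h.2 γ hγΓ a ha
  have hflow : γ.flow a.1 a.2 = γ.value := by
    rw [h.flow_eq hx.skew hγΓ hpos.le, if_pos ha]
  refine γ.value_pos.trans_le (hflow.symm.le.trans ?_)
  refine Multiset.single_le_sum (fun r hr => ?_) _ (Multiset.mem_map_of_mem _ hγ)
  obtain ⟨δ, hδ, rfl⟩ := Multiset.mem_map.1 hr
  exact h.flow_nonneg hx.skew (Multiset.mem_of_le hle hδ) hpos.le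

/-- In a feasible circulation the chain flows use original arcs only. -/
theorem arc (h : IsStandardChainDecomposition Γ x)
    (hf : M.IsFeasible x) {γ : CycleFlow M} (hγ : γ ∈ Γ) {v w : W}
    (ha : (v, w) ∈ cycleArcs γ.nodes) : M.Arc v w := by
  rcases γ.isArc _ ha with h1 | h1
  · exact h1
  · have h2 := hf v w (γ.isArc _ ha)
    have h3 := h.2 γ hγ _ ha
    rw [M.cap_rev w v h1] at h2
    have h4 : x v w ≤ 0 := EReal.coe_le_coe_iff.1 h2
    simp only at h3
    linarith

end IsStandardChainDecomposition

/-! ### Existence of minimum-cost circulations -/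

theorem CycleFlow.abs_flow_le {W : Type*} [DecidableEq W] {M : ArcNet W} (γ : CycleFlow M)
    (v w : W) : |γ.flow v w| ≤ γ.value := by
  have := γ.value_pos
  unfold CycleFlow.flow
  rw [abs_le]
  split_ifs <;> constructor <;> linarith

theorem abs_totalFlow_le {W : Type*} [DecidableEq W] {M : ArcNet W} (Γ : Multiset (CycleFlow M))
    (v w : W) : |totalFlow Γ v w| ≤ (Γ.map fun γ => γ.value).sum := by
  induction Γ using Multiset.induction with
  | empty => simp [totalFlow]
  | cons γ Γ ih =>
    rw [totalFlow_cons, Multiset.map_cons, Multiset.sum_cons]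
    exact (abs_add_le _ _).trans (add_le_add (γ.abs_flow_le v w) ih)

namespace ArcNet

variable {W : Type*} {M : ArcNet W}

theorem IsFeasible.nonneg {x : W → W → ℝ} (hf : M.IsFeasible x) (hx : ∀ v w, x w v = -x v w)
    {v w : W} (h : M.Arc v w) : 0 ≤ x v w := by
  have h1 := hf w v (Or.inr h)
  rw [M.cap_rev v w h, hx v w] at h1
  have h2 : -x v w ≤ 0 := EReal.coe_le_coe_iff.1 h1
  linarith

open Classical in
/-- The sum of all finite capacities of original arcs. -/
def finiteCapSum [Fintype W] (M : ArcNet W) : ℝ :=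
  ∑ v, ∑ w, if M.Arc v w ∧ M.cap v w ≠ ⊤ then (M.cap v w).toReal else 0

/-- If each chain flow of a standard chain decomposition uses an arc of finite capacity, then the
total value of the decomposition is at most the sum of the finite capacities. -/
theorem sum_value_le_finiteCapSum [Fintype W] [DecidableEq W] {x : W → W → ℝ}
    (hx : M.IsCirculation x) (hf : M.IsFeasible x) {Γ : Multiset (CycleFlow M)}
    (hΓ : IsStandardChainDecomposition Γ x)
    (hfin : ∀ γ ∈ Γ, ∃ a ∈ cycleArcs γ.nodes, M.cap a.1 a.2 ≠ ⊤) :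
    (Γ.map fun γ => γ.value).sum ≤ M.finiteCapSum := by
  classical
  -- The total flow on the arcs of finite capacity; each chain flow contributes at least its value.
  let L : (W → W → ℝ) → ℝ := fun y =>
    ∑ v, ∑ w, if M.Arc v w ∧ M.cap v w ≠ ⊤ then y v w else 0
  have hLadd : ∀ y z : W → W → ℝ, L (fun v w => y v w + z v w) = L y + L z := by
    intro y z
    simp only [L, ← Finset.sum_add_distrib]
    refine Finset.sum_congr rfl fun v _ => Finset.sum_congr rfl fun w _ => ?_
    split_ifs <;> simp
  have hγ : ∀ γ ∈ Γ, γ.value ≤ L γ.flow := by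
    intro γ hγ
    obtain ⟨⟨v, w⟩, ha, hcap⟩ := hfin γ hγ
    have hpos : ∀ v w, 0 ≤ if M.Arc v w ∧ M.cap v w ≠ ⊤ then γ.flow v w else 0 := by
      intro v w
      split_ifs with h
      · exact hΓ.flow_nonneg hx.skew hγ (hf.nonneg hx.skew h.1)
      · exact le_rfl
    have harc := hΓ.arc hf hγ ha
    calc γ.value = if M.Arc v w ∧ M.cap v w ≠ ⊤ then γ.flow v w else 0 := by
          rw [if_pos ⟨harc, hcap⟩, hΓ.flow_eq hx.skew hγ (hf.nonneg hx.skew harc), if_pos ha]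
      _ ≤ ∑ w, if M.Arc v w ∧ M.cap v w ≠ ⊤ then γ.flow v w else 0 :=
          Finset.single_le_sum (f := fun w => if M.Arc v w ∧ M.cap v w ≠ ⊤ then γ.flow v w else 0)
            (fun w _ => hpos v w) (Finset.mem_univ w)
      _ ≤ L γ.flow :=
          Finset.single_le_sum
            (f := fun v => ∑ w, if M.Arc v w ∧ M.cap v w ≠ ⊤ then γ.flow v w else 0)
            (fun v _ => Finset.sum_nonneg fun w _ => hpos v w) (Finset.mem_univ v)
  have hL : ∀ Δ : Multiset (CycleFlow M), (∀ γ ∈ Δ, γ.value ≤ L γ.flow) →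
      (Δ.map fun γ => γ.value).sum ≤ L (totalFlow Δ) := by
    intro Δ
    induction Δ using Multiset.induction with
    | empty => intro _; simp [L, totalFlow]
    | cons γ Δ ih =>
      intro h
      rw [totalFlow_cons, hLadd, Multiset.map_cons, Multiset.sum_cons]
      exact add_le_add (h γ (Multiset.mem_cons_self _ _))
        (ih fun δ hδ => h δ (Multiset.mem_cons_of_mem hδ))
  refine (hL Γ hγ).trans ?_
  rw [hΓ.totalFlow_eq]
  refine Finset.sum_le_sum fun v _ => Finset.sum_le_sum fun w _ => ?_
  split_ifs with h
  · refine EReal.coe_le_coe_iff.1 ?_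
    rw [EReal.coe_toReal h.2 (ne_bot_of_gt (M.cap_pos v w h.1))]
    exact hf v w (Or.inl h.1)
  · exact le_rfl

theorem isCompact_bounded_feasible_circulations [Fintype W] (B : ℝ) :
    IsCompact {x : W → W → ℝ | M.IsCirculation x ∧ M.IsFeasible x ∧ ∀ v w, |x v w| ≤ B} := by
  have hcont : ∀ v w, Continuous fun x : W → W → ℝ => x v w := fun v w => by fun_prop
  have hK : IsCompact (Set.Icc (fun _ _ => -B) (fun _ _ => B) : Set (W → W → ℝ)) := isCompact_Icc
  have h1 : IsClosed {x : W → W → ℝ | ∀ v w, x w v = -x v w} := by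
    simp only [Set.ofPred_forall]
    exact isClosed_iInter fun v => isClosed_iInter fun w =>
      isClosed_eq (hcont w v) (hcont v w).neg
  have h2 : IsClosed {x : W → W → ℝ | ∀ v w, ¬ M.IsArc v w → x v w = 0} := by
    simp only [Set.ofPred_forall]
    exact isClosed_iInter fun v => isClosed_iInter fun w => isClosed_iInter fun _ =>
      isClosed_eq (hcont v w) continuous_const
  have h3 : IsClosed {x : W → W → ℝ | ∀ v, ∑ w, x v w = 0} := by
    simp only [Set.ofPred_forall]
    exact isClosed_iInter fun v =>
      isClosed_eq (continuous_finsetSum _ fun w _ => hcont v w) continuous_const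
  have h4 : IsClosed {x : W → W → ℝ | M.IsFeasible x} := by
    simp only [IsFeasible, Set.ofPred_forall]
    exact isClosed_iInter fun v => isClosed_iInter fun w => isClosed_iInter fun _ =>
      isClosed_le (continuous_coe_real_ereal.comp (hcont v w)) continuous_const
  convert hK.inter_right (h1.inter (h2.inter (h3.inter h4))) using 1
  ext x
  constructor
  · rintro ⟨hx, hf, hb⟩
    exact ⟨⟨fun v w => (abs_le.1 (hb v w)).1, fun v w => (abs_le.1 (hb v w)).2⟩,
      hx.skew, hx.off_arc, hx.conservation, hf⟩
  · rintro ⟨hb, hs, ho, hc, hf⟩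
    exact ⟨⟨hs, ho, hc⟩, hf, fun v w => abs_le.2 ⟨hb.1 v w, hb.2 v w⟩⟩

/-- A minimum-cost circulation exists unless flow can be sent without bound along a cycle of
negative cost: flow along cycles of infinite capacity can be dropped, and what remains is bounded by
the finite capacities. -/
theorem exists_isMinCostCirculation [Fintype W] [DecidableEq W]
    (h : ∀ c : List W, c ≠ [] → c.Nodup →
      (∀ a ∈ cycleArcs c, M.Arc a.1 a.2 ∧ M.cap a.1 a.2 = ⊤) → 0 ≤ M.cycleCost c) :
    ∃ x, M.IsMinCostCirculation x := by
  classical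
  have hB : 0 ≤ M.finiteCapSum :=
    Finset.sum_nonneg fun v _ => Finset.sum_nonneg fun w _ => by
      split_ifs with h
      · exact EReal.toReal_nonneg (M.cap_pos v w h.1).le
      · exact le_rfl
  have hcont : Continuous fun x : W → W → ℝ => M.cost x := by
    unfold cost
    refine continuous_finsetSum _ fun v _ => continuous_finsetSum _ fun w _ => ?_
    split_ifs <;> fun_prop
  obtain ⟨x, ⟨hx, hf, -⟩, hmin⟩ :=
    (isCompact_bounded_feasible_circulations (M := M) M.finiteCapSum).exists_isMinOn
      ⟨fun _ _ => 0, isCirculation_zero, isFeasible_zero, fun _ _ => by simpa using hB⟩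
      hcont.continuousOn
  refine ⟨x, hx, hf, fun y hy hyf => ?_⟩
  obtain ⟨Γ, hΓ⟩ := hy.exists_decomposition
  let P : CycleFlow M → Prop := fun γ => ∃ a ∈ cycleArcs γ.nodes, M.cap a.1 a.2 ≠ ⊤
  have hle : Γ.filter P ≤ Γ := Multiset.filter_le _ _
  have hcirc := isCirculation_totalFlow (Γ.filter P)
  have hfeas := hΓ.isFeasible_totalFlow hy hyf hle
  have hbound := sum_value_le_finiteCapSum hcirc hfeas (hΓ.mono hy hle)
    fun γ hγ => (Multiset.mem_filter.1 hγ).2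
  have h1 : M.cost x ≤ M.cost (totalFlow (Γ.filter P)) :=
    hmin ⟨hcirc, hfeas, fun v w => (abs_totalFlow_le _ v w).trans hbound⟩
  have h2 : M.cost y = M.cost (totalFlow (Γ.filter P)) +
      M.cost (totalFlow (Γ.filter fun γ => ¬ P γ)) := by
    rw [← cost_add, ← totalFlow_add, Multiset.filter_add_not, hΓ.totalFlow_eq]
  have h3 : 0 ≤ M.cost (totalFlow (Γ.filter fun γ => ¬ P γ)) := by
    rw [cost_totalFlow]
    refine Multiset.sum_nonneg fun r hr => ?_
    obtain ⟨γ, hγ, rfl⟩ := Multiset.mem_map.1 hr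
    rw [Multiset.mem_filter] at hγ
    simp only [P, not_exists, not_and, not_not] at hγ
    exact mul_nonneg γ.value_pos.le (h _ γ.ne_nil γ.nodup fun a ha =>
      ⟨hΓ.arc hyf hγ.1 ha, hγ.2 a ha⟩)
  linarith

end ArcNet

/-! ### Node potentials -/

theorem pathArcs_cons_append_cons {W : Type*} (v : W) (l₁ l₂ : List W) :
    pathArcs (v :: (l₁ ++ v :: l₂)) = cycleArcs (v :: l₁) ++ pathArcs (v :: l₂) := by
  have h1 : v :: (l₁ ++ v :: l₂) = (v :: l₁) ++ (v :: l₂) := by simp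
  have h2 : l₁ ++ v :: l₂ = (l₁ ++ [v]) ++ l₂ := by simp
  rw [pathArcs, List.tail_cons]
  conv_lhs => rw [h1, h2]
  rw [List.zip_append (by simp)]
  simp [cycleArcs, pathArcs]

/-- If no cycle of the relation `R` has negative length, then there are node potentials for the
lengths of the arcs in `R`: the negative of the length of a shortest simple path starting at a
node. -/
theorem exists_potential {W : Type*} [Finite W] (R : W → W → Prop) (len : W → W → ℝ)
    (h : ∀ c : List W, c ≠ [] → c.Nodup → (∀ a ∈ cycleArcs c, R a.1 a.2) →
      0 ≤ ((cycleArcs c).map fun a => len a.1 a.2).sum) :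
    ∃ π : W → ℝ, ∀ v w, R v w → π w ≤ π v + len v w := by
  classical
  have := Fintype.ofFinite W
  let S : W → Set (List W) := fun v =>
    {p | p.Nodup ∧ p.head? = some v ∧ ∀ a ∈ pathArcs p, R a.1 a.2}
  let ℓ : List W → ℝ := fun p => ((pathArcs p).map fun a => len a.1 a.2).sum
  have hfin : ∀ v, (S v).Finite := fun v =>
    (List.finite_length_le W (Fintype.card W)).subset fun p hp => hp.1.length_le_card
  have hne : ∀ v, (S v).Nonempty := fun v => ⟨[v], by simp [S, pathArcs]⟩
  have hmin : ∀ v, ∃ p ∈ S v, ∀ q ∈ S v, ℓ p ≤ ℓ q := fun v =>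
    Set.exists_min_image (S v) ℓ (hfin v) (hne v)
  choose p hp hpmin using hmin
  refine ⟨fun v => -ℓ (p v), fun v w hvw => ?_⟩
  suffices ℓ (p v) ≤ len v w + ℓ (p w) by linarith
  obtain ⟨hnd, hhead, harc⟩ := hp w
  have hcons : pathArcs (v :: p w) = (v, w) :: pathArcs (p w) := by
    obtain ⟨q, hq⟩ := List.head?_eq_some_iff.1 hhead
    rw [hq]; rfl
  have hlen : ℓ (v :: p w) = len v w + ℓ (p w) := by simp [ℓ, hcons]
  have harc' : ∀ a ∈ pathArcs (v :: p w), R a.1 a.2 := by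
    intro a ha
    rw [hcons, List.mem_cons] at ha
    rcases ha with rfl | ha
    · exact hvw
    · exact harc a ha
  rw [← hlen]
  by_cases hv : v ∈ p w
  -- Prepending `v` closes a cycle, which can be cut off because its length is non-negative.
  · obtain ⟨l₁, l₂, hl⟩ := List.append_of_mem hv
    rw [hl] at hnd harc' ⊢
    rw [pathArcs_cons_append_cons] at harc'
    have hnd' : (l₁ ++ [v]).Nodup := by
      refine hnd.sublist ?_
      simp
    have hcyc := h (v :: l₁) (by simp) (by
        rw [List.nodup_append_comm] at hnd'; simpa using hnd')
      fun a ha => harc' a (List.mem_append_left _ ha)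
    have hle := hpmin v (v :: l₂) ⟨hnd.of_append_right, rfl,
      fun a ha => harc' a (List.mem_append_right _ ha)⟩
    have hsum : ℓ (v :: (l₁ ++ v :: l₂)) =
        ((cycleArcs (v :: l₁)).map fun a => len a.1 a.2).sum + ℓ (v :: l₂) := by
      simp only [ℓ, pathArcs_cons_append_cons, List.map_append, List.sum_append]
    linarith
  · exact hpmin v _ ⟨List.nodup_cons.2 ⟨hv, hnd⟩, rfl, harc'⟩

namespace ArcNet.IsMinCostCirculation

variable {W : Type*} [Fintype W] {M : ArcNet W} {x : W → W → ℝ}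

/-- There is no negative cycle in the residual network, since a small amount of flow could be sent
along it. -/
theorem cycleCost_nonneg_of_residual (hx : M.IsMinCostCirculation x) {c : List W} (hne : c ≠ [])
    (hnd : c.Nodup)
    (hc : ∀ a ∈ cycleArcs c, M.IsArc a.1 a.2 ∧ (x a.1 a.2 : EReal) < M.cap a.1 a.2) :
    0 ≤ M.cycleCost c := by
  classical
  have hev : ∀ᶠ ε : ℝ in nhdsWithin 0 (Set.Ioi 0), ∀ a ∈ (cycleArcs c).toFinset,
      ((x a.1 a.2 + ε : ℝ) : EReal) < M.cap a.1 a.2 := by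
    rw [Filter.eventually_all_finset]
    intro a ha
    refine Filter.Eventually.filter_mono nhdsWithin_le_nhds ?_
    have hcont : Continuous fun ε : ℝ => ((x a.1 a.2 + ε : ℝ) : EReal) :=
      continuous_coe_real_ereal.comp (by fun_prop)
    refine hcont.continuousAt.eventually_lt continuousAt_const ?_
    simpa using (hc a (List.mem_toFinset.1 ha)).2
  obtain ⟨ε, hε, hεpos⟩ := (hev.and self_mem_nhdsWithin).exists
  let γ : CycleFlow M := ⟨c, hne, hnd, fun a ha => (hc a ha).1, ε, hεpos⟩
  have hfeas : M.IsFeasible fun v w => x v w + γ.flow v w := by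
    intro v w hvw
    by_cases ha : (v, w) ∈ cycleArcs c
    · refine le_trans (EReal.coe_le_coe_iff.2 ?_) (hε (v, w) (List.mem_toFinset.2 ha)).le
      exact add_le_add le_rfl ((le_abs_self _).trans (γ.abs_flow_le v w))
    · refine le_trans (EReal.coe_le_coe_iff.2 ?_) (hx.2.1 v w hvw)
      have : γ.flow v w ≤ 0 := by
        rw [CycleFlow.flow, if_neg ha]
        split_ifs
        · exact (zero_sub ε).le.trans (neg_nonpos.2 hεpos.le)
        · simp
      linarith
  have hle := hx.2.2 _ (hx.1.add γ.isCirculation_flow) hfeas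
  rw [cost_add, γ.cost_flow] at hle
  exact nonneg_of_mul_nonneg_right (by linarith : 0 ≤ γ.value * M.cycleCost γ.nodes) hεpos

theorem exists_potential (hx : M.IsMinCostCirculation x) :
    ∃ π : W → ℝ, ∀ v w, M.IsArc v w → (x v w : EReal) < M.cap v w →
      π w ≤ π v + M.transit v w := by
  obtain ⟨π, hπ⟩ := FlowOverTime.exists_potential
    (fun v w => M.IsArc v w ∧ (x v w : EReal) < M.cap v w) M.transit
    fun c hne hnd hc => hx.cycleCost_nonneg_of_residual hne hnd hc
  exact ⟨π, fun v w h1 h2 => hπ v w ⟨h1, h2⟩⟩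

/-- A standard chain decomposition of a minimum-cost circulation remains one of a minimum-cost
circulation when only the cycles of negative cost are kept. -/
theorem exists_negative_decomposition [DecidableEq W] (hx : M.IsMinCostCirculation x) :
    ∃ Γ : Multiset (CycleFlow M), M.IsMinCostCirculation (totalFlow Γ) ∧
      IsStandardChainDecomposition Γ (totalFlow Γ) ∧ ∀ γ ∈ Γ, M.cycleCost γ.nodes < 0 := by
  obtain ⟨Γ, hΓ⟩ := hx.1.exists_decomposition
  let P : CycleFlow M → Prop := fun γ => M.cycleCost γ.nodes < 0
  have hle : Γ.filter P ≤ Γ := Multiset.filter_le _ _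
  refine ⟨Γ.filter P, ⟨isCirculation_totalFlow _, hΓ.isFeasible_totalFlow hx.1 hx.2.1 hle, ?_⟩,
    hΓ.mono hx.1 hle, fun γ hγ => (Multiset.mem_filter.1 hγ).2⟩
  intro y hy hyf
  refine le_trans ?_ (hx.2.2 y hy hyf)
  have h2 : M.cost x = M.cost (totalFlow (Γ.filter P)) +
      M.cost (totalFlow (Γ.filter fun γ => ¬ P γ)) := by
    rw [← cost_add, ← totalFlow_add, Multiset.filter_add_not, hΓ.totalFlow_eq]
  have h3 : 0 ≤ M.cost (totalFlow (Γ.filter fun γ => ¬ P γ)) := by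
    rw [cost_totalFlow]
    refine Multiset.sum_nonneg fun r hr => ?_
    obtain ⟨γ, hγ, rfl⟩ := Multiset.mem_map.1 hr
    exact mul_nonneg γ.value_pos.le (not_lt.1 (Multiset.mem_filter.1 hγ).2)
  linarith

end ArcNet.IsMinCostCirculation

/-! ### The amount of flow is at most the negative of the cost -/

namespace ArcNet

variable {W : Type*} {M : ArcNet W} {x : W → W → ℝ}

/-- Complementary slackness of a circulation and potentials for its residual network, for the
reduced cost `transit v w + π v - π w`. -/
theorem complementary_slackness (hskew : ∀ v w, x w v = -x v w) (hf : M.IsFeasible x)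
    {π : W → ℝ} (hπ : ∀ v w, M.IsArc v w → (x v w : EReal) < M.cap v w →
      π w ≤ π v + M.transit v w) {v w : W} (h : M.Arc v w) :
    (0 ≤ M.transit v w + π v - π w ∧ (M.transit v w + π v - π w) * x v w = 0) ∨
      (M.transit v w + π v - π w ≤ 0 ∧ M.cap v w = x v w) := by
  by_cases h1 : (x v w : EReal) < M.cap v w
  · left
    have h2 := hπ v w (Or.inl h) h1
    refine ⟨by linarith, ?_⟩
    by_cases h3 : (x w v : EReal) < M.cap w v
    · have h4 := hπ w v (Or.inr h) h3
      rw [M.transit_rev v w h] at h4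
      rw [show M.transit v w + π v - π w = 0 by linarith, zero_mul]
    · rw [M.cap_rev v w h, not_lt] at h3
      have h4 : 0 ≤ x w v := EReal.coe_le_coe_iff.1 h3
      have h5 := hf.nonneg hskew h
      rw [hskew v w] at h4
      rw [show x v w = 0 by linarith, mul_zero]
  · have hcap : M.cap v w = x v w := le_antisymm (not_lt.1 h1) (hf v w (Or.inl h))
    by_cases h3 : (x w v : EReal) < M.cap w v
    · have h4 := hπ w v (Or.inr h) h3
      rw [M.transit_rev v w h] at h4
      exact Or.inr ⟨by linarith, hcap⟩
    · -- `x` would vanish on `vw`, which is saturated and has positive capacity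
      exfalso
      rw [M.cap_rev v w h, not_lt] at h3
      have h4 : 0 ≤ x w v := EReal.coe_le_coe_iff.1 h3
      rw [hskew v w] at h4
      have h5 := M.cap_pos v w h
      rw [hcap] at h5
      have h6 : 0 < x v w := EReal.coe_lt_coe_iff.1 h5
      linarith

open Classical in
theorem cost_eq_sum_reducedCost [Fintype W] (hx : M.IsCirculation x) (π : W → ℝ) :
    M.cost x = ∑ v, ∑ w,
      if M.Arc v w then (M.transit v w + π v - π w) * x v w else 0 := by
  have h := M.sum_eq_sum_arcs (fun v w => π v * x v w)
    (fun v w hvw => by simp only [hx.off_arc v w hvw, mul_zero])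
  have h0 : ∑ v, ∑ w, π v * x v w = 0 := by
    simp only [← Finset.mul_sum, hx.conservation, mul_zero, Finset.sum_const_zero]
  rw [h0] at h
  refine (add_zero (M.cost x)).symm.trans ?_
  conv_lhs => rw [h]
  rw [cost]
  simp only [← Finset.sum_add_distrib]
  refine Finset.sum_congr rfl fun v _ => Finset.sum_congr rfl fun w _ => ?_
  split_ifs
  · rw [hx.skew v w]; ring
  · simp

end ArcNet

theorem setIntegral_Ici_comp_sub (g : ℝ → ℝ) (a τ : ℝ) :
    ∫ t in Set.Ici a, g (t - τ) = ∫ t in Set.Ici (a - τ), g t := by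
  rw [← integral_indicator measurableSet_Ici, ← integral_indicator measurableSet_Ici,
    ← integral_sub_right_eq_self ((Set.Ici (a - τ)).indicator g) τ]
  congr 1
  funext t
  simp [Set.indicator_apply]

theorem setIntegral_Ici_sub_of_le {g : ℝ → ℝ} (hg : Integrable g) {a b : ℝ} (hab : a ≤ b) :
    (∫ t in Set.Ici a, g t) - ∫ t in Set.Ici b, g t = ∫ t in Set.Ico a b, g t := by
  rw [sub_eq_iff_eq_add, ← Set.Ico_union_Ici_eq_Ici hab]
  refine setIntegral_union ?_ measurableSet_Ici hg.integrableOn hg.integrableOn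
  exact Set.disjoint_left.2 fun t h1 h2 => absurd h1.2 (not_lt.2 h2)

namespace Network

variable {V : Type*} (N : Network V) {f : V → V → ℝ → ℝ} {θ : ℝ}

theorem HasTimeHorizon.eq_zero [Fintype V] {N : Network V} (h : N.HasTimeHorizon f θ)
    (hf : N.IsFlowOverTime f) {t : ℝ} (ht : t ∉ Set.Ico 0 θ) (v w : V) : f v w t = 0 := by
  by_cases hvw : N.IsArc v w
  · exact h v w hvw t ht
  · exact hf.off_arc v w hvw t

/-- For a cut over time that puts the node `v` on the sink side before time `p v` and on the source
side from time `p v` on, flow conservation turns the amount of flow into the flow across the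
cut. -/
theorem amount_eq_sum_cut [Fintype V] (hf : N.IsFlowOverTime f) (hθ : N.HasTimeHorizon f θ)
    {p : V → ℝ} (hsrc : ∀ s ∈ N.sources, p s ≤ 0) (hsnk : ∀ t ∈ N.sinks, θ ≤ p t) :
    N.amount f = ∑ v, ∑ w, ∫ t in Set.Ici (p v), f v w t := by
  classical
  have hv : ∀ v, ∑ w, ∫ t in Set.Ici (p v), f v w t =
      if v ∈ N.sources then ∑ w, ∫ t, f v w t else 0 := by
    intro v
    split_ifs with h1
    · refine Finset.sum_congr rfl fun w _ => ?_
      refine setIntegral_eq_integral_of_forall_compl_eq_zero fun t ht => ?_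
      refine hθ.eq_zero hf (fun h => ht ?_) v w
      exact (hsrc v h1).trans h.1
    by_cases h2 : v ∈ N.sinks
    · refine Finset.sum_eq_zero fun w _ => ?_
      refine setIntegral_eq_zero_of_forall_eq_zero fun t ht => ?_
      refine hθ.eq_zero hf (fun h => ?_) v w
      exact absurd h.2 (not_lt.2 ((hsnk v h2).trans ht))
    · rw [← integral_finsetSum _ fun w _ => (hf.integrable v w).integrableOn]
      simp only [hf.conservation v h1 h2, integral_zero]
  simp only [hv, amount, Finset.sum_ite_mem, Finset.univ_inter]

variable [DecidableEq V]

/-- Weak duality: no feasible flow over time sends more than the negative of the minimum cost. The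
cut over time is given by potentials for the residual network. -/
theorem amount_le [Fintype V] {x : Option V → Option V → ℝ}
    (hx : (N.extended θ N.sources).IsMinCostCirculation x)
    (hf : N.IsFlowOverTime f) (hfeas : N.IsFeasibleOverTime f) (hhor : N.HasTimeHorizon f θ) :
    N.amount f ≤ -(N.extended θ N.sources).cost x := by
  classical
  obtain ⟨π, hπ⟩ := hx.exists_potential
  set M := N.extended θ N.sources
  obtain ⟨hcirc, hxf, -⟩ := hx
  have hsl : ∀ v w, M.Arc v w → _ := fun v w h => M.complementary_slackness hcirc.skew hxf hπ h
  have hsrcArc : ∀ s ∈ N.sources, M.Arc none (some s) := fun s hs => ⟨hs, hs⟩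
  have hsnkArc : ∀ t ∈ N.sinks, M.Arc (some t) none := fun t ht =>
    ⟨ht, fun h => Finset.disjoint_left.1 N.disjoint h ht⟩
  have hnoneSome : ∀ s, M.Arc none (some s) → M.cap none (some s) = ⊤ := fun s h => if_pos h
  have hsomeNone : ∀ t, M.Arc (some t) none → M.cap (some t) none = ⊤ := fun t h => if_pos h
  have htop : ∀ v w, M.Arc v w → M.cap v w = ⊤ →
      (M.transit v w + π v - π w) * x v w = 0 ∧ 0 ≤ M.transit v w + π v - π w := by
    intro v w h hcap
    rcases hsl v w h with h' | h'
    · exact ⟨h'.2, h'.1⟩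
    · rw [hcap] at h'
      exact absurd h'.2.symm (EReal.coe_ne_top _)
  -- Normalizing the potential of the super-source to `0` puts the sources on the source side of
  -- the cut and the sinks on the sink side during the whole interval `[0, θ)`.
  let p : V → ℝ := fun v => π (some v) - π none
  have hsrc : ∀ s ∈ N.sources, p s ≤ 0 := fun s hs => by
    have h1 := (htop _ _ (hsrcArc s hs) (hnoneSome s (hsrcArc s hs))).2
    have h2 : M.transit none (some s) = 0 :=
      if_neg fun h => Finset.disjoint_left.1 N.disjoint hs h.1
    simp only [p]; linarith
  have hsnk : ∀ t ∈ N.sinks, θ ≤ p t := fun t ht => by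
    have h1 := (htop _ _ (hsnkArc t ht) (hsomeNone t (hsnkArc t ht))).2
    have h2 : M.transit (some t) none = -θ := if_pos (hsnkArc t ht)
    simp only [p]; linarith
  have hcost : M.cost x = ∑ v, ∑ w, if N.Arc v w then
      (N.transit v w + p v - p w) * x (some v) (some w) else 0 := by
    have h1 : ∀ w, (if M.Arc none w then (M.transit none w + π none - π w) * x none w else 0)
        = 0 := by
      rintro (_ | s)
      · exact if_neg fun h => h
      · split_ifs with h
        · exact (htop _ _ h (hnoneSome s h)).1
        · rfl
    have h2 : ∀ v, (if M.Arc (some v) none then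
        (M.transit (some v) none + π (some v) - π none) * x (some v) none else 0) = 0 := by
      intro v
      split_ifs with h
      · exact (htop _ _ h (hsomeNone v h)).1
      · rfl
    rw [ArcNet.cost_eq_sum_reducedCost hcirc π, Fintype.sum_option]
    simp only [h1, Finset.sum_const_zero, zero_add]
    refine Finset.sum_congr rfl fun v _ => ?_
    rw [Fintype.sum_option, h2, zero_add]
    refine Finset.sum_congr rfl fun w _ => ?_
    have h3 : M.Arc (some v) (some w) ↔ N.Arc v w := Iff.rfl
    have h4 : M.transit (some v) (some w) = N.transit v w := rfl
    simp only [h3, h4, p]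
    split_ifs <;> ring
  rw [N.amount_eq_sum_cut hf hhor hsrc hsnk,
    N.sum_eq_sum_arcs (fun v w => ∫ t in Set.Ici (p v), f v w t)
      (fun v w h => by simp only [hf.off_arc v w h, integral_zero]),
    hcost, ← Finset.sum_neg_distrib]
  refine Finset.sum_le_sum fun v _ => ?_
  rw [← Finset.sum_neg_distrib]
  refine Finset.sum_le_sum fun w _ => ?_
  split_ifs with hvw
  swap
  · simp
  have hin : ∫ t in Set.Ici (p w), f w v t =
      -∫ t in Set.Ici (p w - N.transit v w), f v w t := by
    simp only [hf.skew v w (Or.inl hvw), integral_neg]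
    rw [setIntegral_Ici_comp_sub (f v w)]
  have hint := hf.integrable v w
  rw [hin, ← sub_eq_add_neg]
  have hrc : M.transit (some v) (some w) + π (some v) - π (some w) =
      N.transit v w + p v - p w := by
    have h4 : M.transit (some v) (some w) = N.transit v w := rfl
    simp only [h4, p]; ring
  rcases hsl (some v) (some w) hvw with ⟨h1, h2⟩ | ⟨h1, h2⟩
  -- Non-negative reduced cost: flow on `vw` crosses the cut backwards only.
  · rw [hrc] at h1 h2
    rw [h2, neg_zero]
    have h3 := setIntegral_Ici_sub_of_le hint (by linarith : p w - N.transit v w ≤ p v)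
    have h4 : 0 ≤ ∫ t in Set.Ico (p w - N.transit v w) (p v), f v w t := by
      refine setIntegral_nonneg measurableSet_Ico fun t _ => ?_
      have h5 := hfeas w v (Or.inr hvw) (t + N.transit v w)
      rw [N.cap_rev v w hvw, hf.skew v w (Or.inl hvw), add_sub_cancel_right] at h5
      have h6 : -f v w t ≤ 0 := EReal.coe_le_coe_iff.1 h5
      linarith
    linarith
  -- Non-positive reduced cost: `x` saturates `vw`, so `x v w` bounds the rate across the cut.
  · rw [hrc] at h1
    have hle : p v ≤ p w - N.transit v w := by linarith
    rw [setIntegral_Ici_sub_of_le hint hle]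
    have h3 : ∫ t in Set.Ico (p v) (p w - N.transit v w), f v w t ≤
        ∫ t in Set.Ico (p v) (p w - N.transit v w), x (some v) (some w) := by
      refine setIntegral_mono hint.integrableOn (by simp) fun t => ?_
      have h5 := hfeas v w (Or.inl hvw) t
      have h6 : N.cap v w = x (some v) (some w) := h2
      rw [h6] at h5
      exact EReal.coe_le_coe_iff.1 h5
    refine h3.trans (le_of_eq ?_)
    rw [setIntegral_const, Real.volume_real_Ico_of_le hle, smul_eq_mul]
    ring

end Network

/-! ### Arcs of simple paths -/

section pathArcs

variable {W : Type*}

theorem pathArcs_append_singleton {l : List W} (h : l ≠ []) (b : W) :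
    pathArcs (l ++ [b]) = pathArcs l ++ [(l.getLast h, b)] := by
  induction l with
  | nil => exact absurd rfl h
  | cons a l ih =>
    cases l with
    | nil => rfl
    | cons c l =>
      have := ih (by simp)
      simp only [pathArcs, List.cons_append, List.tail_cons, List.zip_cons_cons,
        List.getLast_cons_cons] at this ⊢
      rw [this]

theorem cycleArcs_eq_pathArcs_append (p : List W) (h : p ≠ []) :
    cycleArcs p = pathArcs p ++ [(p.getLast h, p.head h)] := by
  obtain ⟨a, l, rfl⟩ := List.exists_cons_of_ne_nil h
  have h1 := pathArcs_cons_append_cons a l []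
  rw [← List.cons_append, pathArcs_append_singleton h] at h1
  simpa [pathArcs] using h1.symm

theorem pathArcs_map {W' : Type*} (f : W → W') (p : List W) :
    pathArcs (p.map f) = (pathArcs p).map (Prod.map f f) := by
  rw [pathArcs, ← List.map_tail, List.zip_map]
  rfl

theorem pathArcs_take_succ (p : List W) (i : ℕ) :
    pathArcs (p.take (i + 1)) = (pathArcs p).take i := by
  induction p generalizing i with
  | nil => simp [pathArcs]
  | cons a l ih =>
    cases l with
    | nil => simp [pathArcs]
    | cons b l =>
      cases i with
      | zero => simp [pathArcs]
      | succ i =>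
        have := ih i
        simp only [pathArcs, List.take_succ_cons, List.tail_cons, List.zip_cons_cons] at this ⊢
        rw [this]

variable [DecidableEq W]

/-- A simple path is the simple cycle on its nodes without the closing arc. -/
theorem ite_mem_pathArcs {p : List W} (hp : p.Nodup) (h : p ≠ []) (r : ℝ) (v w : W) :
    (if (v, w) ∈ pathArcs p then r else 0) = (if (v, w) ∈ cycleArcs p then r else 0) -
      if v = p.getLast h ∧ w = p.head h then r else 0 := by
  have hnd := nodup_cycleArcs hp
  rw [cycleArcs_eq_pathArcs_append p h] at hnd ⊢
  have hdis := (List.nodup_append.1 hnd).2.2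
  by_cases h1 : (v, w) ∈ pathArcs p
  · have h2 : ¬ (v = p.getLast h ∧ w = p.head h) := fun h2 =>
      hdis _ h1 _ (List.mem_singleton_self _) (Prod.ext h2.1 h2.2)
    simp [h1, h2]
  · simp [h1]

theorem sum_pathArcs_out [Fintype W] {p : List W} (hp : p.Nodup) (h : p ≠ []) (v : W) :
    (∑ w, if (v, w) ∈ pathArcs p then (1 : ℝ) else 0) =
      (if v ∈ p then 1 else 0) - if v = p.getLast h then 1 else 0 := by
  simp only [ite_mem_pathArcs hp h, Finset.sum_sub_distrib, sum_cycleArcs_out hp]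
  by_cases hv : v = p.getLast h <;> simp [hv]

theorem sum_pathArcs_in [Fintype W] {p : List W} (hp : p.Nodup) (h : p ≠ []) (v : W) :
    (∑ w, if (w, v) ∈ pathArcs p then (1 : ℝ) else 0) =
      (if v ∈ p then 1 else 0) - if v = p.head h then 1 else 0 := by
  simp only [ite_mem_pathArcs hp h, Finset.sum_sub_distrib, sum_cycleArcs_in hp]
  by_cases hv : v = p.head h <;> simp [hv]

end pathArcs

namespace Network

variable {V : Type*} (N : Network V)

/-! ### Flow sent into a single path -/

/-- `p` is the node list of a simple path of original arcs from a source to a sink. -/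
structure IsSourceSinkPath (p : List V) : Prop where
  ne_nil : p ≠ []
  nodup : p.Nodup
  arc : ∀ a ∈ pathArcs p, N.Arc a.1 a.2
  head_mem : p.head ne_nil ∈ N.sources
  last_mem : p.getLast ne_nil ∈ N.sinks

theorem isFlowOverTime_zero [Fintype V] : N.IsFlowOverTime fun _ _ _ => 0 where
  integrable _ _ := integrable_zero _ _ _
  off_arc _ _ _ _ := rfl
  skew _ _ _ _ := by simp
  conservation _ _ _ _ := by simp

theorem amount_zero [Fintype V] : N.amount (fun _ _ _ => 0) = 0 := by simp [amount]

variable {N}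

theorem IsFlowOverTime.add [Fintype V] {f g : V → V → ℝ → ℝ} (hf : N.IsFlowOverTime f)
    (hg : N.IsFlowOverTime g) : N.IsFlowOverTime fun v w t => f v w t + g v w t where
  integrable v w := (hf.integrable v w).add (hg.integrable v w)
  off_arc v w h t := by rw [hf.off_arc v w h, hg.off_arc v w h, add_zero]
  skew v w h t := by rw [hf.skew v w h, hg.skew v w h]; ring
  conservation v h1 h2 t := by
    rw [Finset.sum_add_distrib, hf.conservation v h1 h2, hg.conservation v h1 h2, add_zero]

theorem amount_add [Fintype V] {f g : V → V → ℝ → ℝ} (hf : N.IsFlowOverTime f)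
    (hg : N.IsFlowOverTime g) :
    N.amount (fun v w t => f v w t + g v w t) = N.amount f + N.amount g := by
  simp only [amount, ← Finset.sum_add_distrib]
  refine Finset.sum_congr rfl fun v _ => Finset.sum_congr rfl fun w _ => ?_
  exact integral_add (hf.integrable v w) (hg.integrable v w)

namespace IsSourceSinkPath

variable {p : List V}

theorem arc_transit_nonneg (hp : N.IsSourceSinkPath p) :
    ∀ r ∈ (pathArcs p).map fun a => N.transit a.1 a.2, 0 ≤ r := by
  intro r hr
  obtain ⟨a, ha, rfl⟩ := List.mem_map.1 hr
  exact N.transit_nonneg _ _ (hp.arc a ha)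

theorem pathTransit_take_nonneg (hp : N.IsSourceSinkPath p) (i : ℕ) :
    0 ≤ N.pathTransit (p.take (i + 1)) := by
  rw [pathTransit, pathArcs_take_succ, List.map_take]
  exact List.sum_nonneg fun r hr => hp.arc_transit_nonneg r (List.mem_of_mem_take hr)

theorem pathTransit_take_le (hp : N.IsSourceSinkPath p) (i : ℕ) :
    N.pathTransit (p.take (i + 1)) ≤ N.pathTransit p := by
  rw [pathTransit, pathArcs_take_succ, List.map_take, pathTransit]
  exact (List.take_sublist _ _).sum_le_sum hp.arc_transit_nonneg

variable [DecidableEq V]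

/-- Along an arc of the path the length of the initial segment grows by its transit time. -/
theorem pathTransit_take_idxOf (hp : N.IsSourceSinkPath p) {v w : V} (h : (v, w) ∈ pathArcs p) :
    N.pathTransit (p.take (p.idxOf w + 1)) =
      N.pathTransit (p.take (p.idxOf v + 1)) + N.transit v w := by
  obtain ⟨i, hi, heq⟩ := List.mem_iff_getElem.1 h
  have hlen : i + 1 < p.length := by
    have := hi
    simp only [pathArcs, List.length_zip, List.length_tail] at this
    omega
  have h1 : p[i] = v ∧ p[i + 1] = w := by
    simpa [pathArcs, List.getElem_zip] using heq
  have hv : p.idxOf v = i := by rw [← h1.1, hp.nodup.idxOf_getElem]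
  have hw : p.idxOf w = i + 1 := by rw [← h1.2, hp.nodup.idxOf_getElem]
  rw [hv, hw, pathTransit, pathTransit, pathArcs_take_succ, pathArcs_take_succ,
    List.take_add_one, List.getElem?_eq_getElem hi, heq]
  simp

open Classical in
/-- The net rate of flow on the pair of opposite arcs `vw`, `wv`, if flow is sent into a path: it is
the rate at the start of the path, shifted by the time that flow needs to get to `v`. -/
theorem pathRate_sub_pathRate (hp : N.IsSourceSinkPath p) (θ r : ℝ) (v w : V) (t : ℝ) :
    N.pathRate θ p r v w t - N.pathRate θ p r w v (t - N.transit w v) =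
      ((if (v, w) ∈ pathArcs p then 1 else 0) - (if (w, v) ∈ pathArcs p then 1 else 0)) *
        (Set.Ico 0 (θ - N.pathTransit p)).indicator (fun _ => r)
          (t - N.pathTransit (p.take (p.idxOf v + 1))) := by
  have h1 : N.pathRate θ p r v w t = (if (v, w) ∈ pathArcs p then 1 else 0) *
      (Set.Ico 0 (θ - N.pathTransit p)).indicator (fun _ => r)
        (t - N.pathTransit (p.take (p.idxOf v + 1))) := by
    rw [pathRate, ite_and, Set.indicator_apply]
    split_ifs <;> simp
  have h2 : N.pathRate θ p r w v (t - N.transit w v) = (if (w, v) ∈ pathArcs p then 1 else 0) *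
      (Set.Ico 0 (θ - N.pathTransit p)).indicator (fun _ => r)
        (t - N.pathTransit (p.take (p.idxOf v + 1))) := by
    rw [pathRate, ite_and]
    by_cases h : (w, v) ∈ pathArcs p
    · rw [if_pos h, if_pos h, hp.pathTransit_take_idxOf h, Set.indicator_apply, sub_sub,
        add_comm (N.transit w v), one_mul]
    · rw [if_neg h, if_neg h, zero_mul]
  rw [h1, h2, sub_mul]

theorem isFlowOverTime [Fintype V] (hp : N.IsSourceSinkPath p) (θ r : ℝ) :
    N.IsFlowOverTime fun v w t =>
      N.pathRate θ p r v w t - N.pathRate θ p r w v (t - N.transit w v) where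
  integrable v w := by
    simp only [hp.pathRate_sub_pathRate]
    refine Integrable.const_mul ?_ _
    refine Integrable.comp_sub_right (μ := volume) ?_ _
    rw [integrable_indicator_iff measurableSet_Ico]
    simp
  off_arc v w h t := by
    rw [hp.pathRate_sub_pathRate, if_neg fun h' => h (Or.inl (hp.arc _ h')),
      if_neg fun h' => h (Or.inr (hp.arc _ h')), sub_self, zero_mul]
  skew v w h t := by
    rw [ArcNet.transit_symm h, sub_neg_eq_add, sub_add_cancel]
    ring
  conservation v h1 h2 t := by
    classical
    simp only [hp.pathRate_sub_pathRate]
    rw [← Finset.sum_mul, Finset.sum_sub_distrib]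
    have h3 := sum_pathArcs_out hp.nodup hp.ne_nil v
    have h4 := sum_pathArcs_in hp.nodup hp.ne_nil v
    rw [if_neg (c := v = _) fun h => h2 (h ▸ hp.last_mem)] at h3
    rw [if_neg (c := v = _) fun h => h1 (h ▸ hp.head_mem)] at h4
    refine mul_eq_zero_of_left ?_ _
    convert sub_eq_zero.2 (h3.trans h4.symm)

theorem hasTimeHorizon (hp : N.IsSourceSinkPath p) (θ r : ℝ) :
    N.HasTimeHorizon (fun v w t =>
      N.pathRate θ p r v w t - N.pathRate θ p r w v (t - N.transit w v)) θ := by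
  intro v w _ t ht
  simp only [hp.pathRate_sub_pathRate]
  refine mul_eq_zero_of_right _ (Set.indicator_of_notMem (fun h => ht ?_) _)
  have h1 := hp.pathTransit_take_nonneg (p.idxOf v)
  have h2 := hp.pathTransit_take_le (p.idxOf v)
  exact ⟨by linarith [h.1], by linarith [h.2]⟩

theorem amount_eq [Fintype V] (hp : N.IsSourceSinkPath p) {θ : ℝ} (hθ : N.pathTransit p ≤ θ)
    (r : ℝ) :
    N.amount (fun v w t =>
      N.pathRate θ p r v w t - N.pathRate θ p r w v (t - N.transit w v)) =
      r * (θ - N.pathTransit p) := by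
  classical
  have hint : ∀ d : ℝ, ∫ t, (Set.Ico 0 (θ - N.pathTransit p)).indicator (fun _ => r) (t - d) =
      r * (θ - N.pathTransit p) := by
    intro d
    rw [integral_sub_right_eq_self
      (fun t => (Set.Ico 0 (θ - N.pathTransit p)).indicator (fun _ => r) t) d,
      integral_indicator measurableSet_Ico, setIntegral_const,
      Real.volume_real_Ico_of_le (by linarith), smul_eq_mul]
    ring
  have hs : ∀ s ∈ N.sources, (∑ w, ∫ t,
      (N.pathRate θ p r s w t - N.pathRate θ p r w s (t - N.transit w s))) =
      if s = p.head hp.ne_nil then r * (θ - N.pathTransit p) else 0 := by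
    intro s hs
    simp only [hp.pathRate_sub_pathRate, integral_const_mul, hint]
    rw [← Finset.sum_mul, Finset.sum_sub_distrib]
    have h3 := sum_pathArcs_out hp.nodup hp.ne_nil s
    have h4 := sum_pathArcs_in hp.nodup hp.ne_nil s
    rw [if_neg (c := s = _) fun h => Finset.disjoint_left.1 N.disjoint hs (h ▸ hp.last_mem)] at h3
    have h5 : (∑ w, if (s, w) ∈ pathArcs p then (1 : ℝ) else 0) -
        (∑ w, if (w, s) ∈ pathArcs p then (1 : ℝ) else 0) =
        if s = p.head hp.ne_nil then 1 else 0 := by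
      rw [h3, h4]; ring
    rw [← boole_mul]
    convert congrArg (· * (r * (θ - N.pathTransit p))) h5
  rw [amount, Finset.sum_congr rfl hs, Finset.sum_ite_eq', if_pos hp.head_mem]

theorem rate_nonpos_of_arc_symm (hp : N.IsSourceSinkPath p) {θ r : ℝ} (hr : 0 ≤ r) {v w : V}
    (h : N.Arc w v) (t : ℝ) :
    N.pathRate θ p r v w t - N.pathRate θ p r w v (t - N.transit w v) ≤ 0 := by
  classical
  rw [hp.pathRate_sub_pathRate, if_neg (c := (v, w) ∈ _) fun h' => N.asymm w v h (hp.arc _ h')]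
  have := Set.indicator_nonneg (s := Set.Ico 0 (θ - N.pathTransit p)) (f := fun _ => r)
    (fun _ _ => hr) (t - N.pathTransit (p.take (p.idxOf v + 1)))
  split_ifs <;> linarith

theorem rate_le_of_arc (hp : N.IsSourceSinkPath p) {θ r : ℝ} (hr : 0 ≤ r) {v w : V}
    (h : N.Arc v w) (t : ℝ) :
    N.pathRate θ p r v w t - N.pathRate θ p r w v (t - N.transit w v) ≤
      if (v, w) ∈ pathArcs p then r else 0 := by
  classical
  rw [hp.pathRate_sub_pathRate, if_neg (c := (w, v) ∈ _) fun h' => N.asymm v w h (hp.arc _ h')]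
  have : (Set.Ico 0 (θ - N.pathTransit p)).indicator (fun _ => r)
      (t - N.pathTransit (p.take (p.idxOf v + 1))) ≤ r :=
    Set.indicator_le_self' (fun _ _ => hr) _
  split_ifs <;> linarith

end IsSourceSinkPath

/-! ### Temporally repeated flows -/

theorem cycleArcs_none_cons_map {p : List V} (h : p ≠ []) :
    cycleArcs (none :: p.map some) = (none, some (p.head h)) ::
      ((pathArcs p).map (Prod.map some some) ++ [(some (p.getLast h), none)]) := by
  rw [cycleArcs_eq_pathArcs_append _ (by simp)]
  obtain ⟨a, l, rfl⟩ := List.exists_cons_of_ne_nil h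
  have h1 : pathArcs (none :: (a :: l).map some) =
      (none, some a) :: pathArcs ((a :: l).map some) := rfl
  have h2 : (none :: (a :: l).map some).getLast (by simp) = some ((a :: l).getLast h) := by
    rw [List.getLast_cons (by simp), List.getLast_map]
  rw [h1, h2, pathArcs_map]
  rfl

section extended

variable [DecidableEq V] {θ : ℝ}

theorem none_mem_of_cycleCost_neg {c : List (Option V)} (hnd : c.Nodup)
    (harc : ∀ a ∈ cycleArcs c, (N.extended θ N.sources).Arc a.1 a.2)
    (hneg : (N.extended θ N.sources).cycleCost c < 0) : none ∈ c := by
  by_contra h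
  refine absurd hneg (not_lt.2 (List.sum_nonneg fun r hr => ?_))
  obtain ⟨⟨a, b⟩, hab, rfl⟩ := List.mem_map.1 hr
  have harc := harc _ hab
  rw [mem_cycleArcs_iff hnd] at hab
  have hb : b ∈ c := hab.2 ▸ List.formPerm_apply_mem_of_mem hab.1
  rcases a with _ | v
  · exact absurd hab.1 h
  rcases b with _ | w
  · exact absurd hb h
  exact N.transit_nonneg v w harc

theorem rotate_idxOf_none {c : List (Option V)} (hnd : c.Nodup) (hmem : none ∈ c) :
    c.rotate (c.idxOf none) = none :: ((c.rotate (c.idxOf none)).reduceOption).map some := by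
  have hlt : c.idxOf none < c.length := List.idxOf_lt_length_iff.2 hmem
  have hnd' : (c.rotate (c.idxOf none)).Nodup := List.nodup_rotate.2 hnd
  have hq : c.rotate (c.idxOf none) =
      none :: (c.drop (c.idxOf none + 1) ++ c.take (c.idxOf none)) := by
    rw [List.rotate_eq_drop_append_take hlt.le, List.drop_eq_getElem_cons hlt,
      List.getElem_idxOf hlt, List.cons_append]
  rw [hq] at hnd' ⊢
  have key : ∀ q : List (Option V), none ∉ q → q = q.reduceOption.map some := by
    intro q
    induction q with
    | nil => simp
    | cons a q ih =>
      intro h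
      rw [List.mem_cons, not_or] at h
      rcases a with _ | a
      · exact absurd rfl h.1
      · rw [List.reduceOption_cons_of_some, List.map_cons, ← ih h.2]
  rw [List.reduceOption_cons_of_none, ← key _ (List.nodup_cons.1 hnd').1]

variable {γ : CycleFlow (N.extended θ N.sources)}

/-- The arcs of a cycle of negative cost: only arcs into the super-source have negative cost, so the
cycle passes through it and consists of a source-sink path and two arcs at the super-source. -/
theorem cycleArcs_of_cycleCost_neg
    (harc : ∀ a ∈ cycleArcs γ.nodes, (N.extended θ N.sources).Arc a.1 a.2)
    (hneg : (N.extended θ N.sources).cycleCost γ.nodes < 0) :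
    ∃ hne : N.sourceSinkPath γ ≠ [],
      (N.sourceSinkPath γ).Nodup ∧
      (∀ a, a ∈ cycleArcs γ.nodes ↔ a = (none, some ((N.sourceSinkPath γ).head hne)) ∨
        a ∈ (pathArcs (N.sourceSinkPath γ)).map (Prod.map some some) ∨
        a = (some ((N.sourceSinkPath γ).getLast hne), none)) ∧
      (N.extended θ N.sources).cycleCost γ.nodes =
        (N.extended θ N.sources).transit none (some ((N.sourceSinkPath γ).head hne)) +
        N.pathTransit (N.sourceSinkPath γ) +
        (N.extended θ N.sources).transit (some ((N.sourceSinkPath γ).getLast hne)) none := by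
  have hmem := none_mem_of_cycleCost_neg γ.nodup harc hneg
  have hrot := rotate_idxOf_none γ.nodup hmem
  rw [← sourceSinkPath] at hrot
  set p := N.sourceSinkPath γ
  have hnd : (none :: p.map some).Nodup := hrot ▸ List.nodup_rotate.2 γ.nodup
  have harcs : ∀ a, a ∈ cycleArcs γ.nodes ↔ a ∈ cycleArcs (none :: p.map some) := by
    rintro ⟨v, w⟩
    rw [mem_cycleArcs_iff γ.nodup, mem_cycleArcs_iff hnd, ← hrot, List.mem_rotate,
      List.formPerm_rotate _ γ.nodup]
  have hne : p ≠ [] := by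
    intro h
    refine harc (none, none) ((harcs _).2 ?_)
    rw [h]
    simp [cycleArcs]
  refine ⟨hne, (List.nodup_cons.1 hnd).2.of_map _, fun a => ?_, ?_⟩
  · rw [harcs, cycleArcs_none_cons_map hne, List.mem_cons, List.mem_append, List.mem_singleton]
  · have h1 : (N.extended θ N.sources).cycleCost γ.nodes =
        (N.extended θ N.sources).cycleCost (none :: p.map some) := by
      exact (((List.perm_ext_iff_of_nodup (nodup_cycleArcs γ.nodup)
        (nodup_cycleArcs hnd)).2 harcs).map _).sum_eq
    rw [h1, ArcNet.cycleCost, cycleArcs_none_cons_map hne, List.map_cons, List.map_append,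
      List.sum_cons, List.sum_append, ← add_assoc, List.map_map]
    congr 1
    simp

theorem isSourceSinkPath_of_cycleCost_neg
    (harc : ∀ a ∈ cycleArcs γ.nodes, (N.extended θ N.sources).Arc a.1 a.2)
    (hneg : (N.extended θ N.sources).cycleCost γ.nodes < 0) :
    N.IsSourceSinkPath (N.sourceSinkPath γ) := by
  obtain ⟨hne, hnd, hmem, -⟩ := cycleArcs_of_cycleCost_neg harc hneg
  refine ⟨hne, hnd, fun a ha => ?_, ?_, ?_⟩
  · exact harc (some a.1, some a.2) ((hmem _).2 (Or.inr (Or.inl (List.mem_map_of_mem ha))))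
  · exact (harc _ ((hmem _).2 (Or.inl rfl))).1
  · exact (harc _ ((hmem _).2 (Or.inr (Or.inr rfl)))).1

theorem throughSuperSource_of_cycleCost_neg
    (harc : ∀ a ∈ cycleArcs γ.nodes, (N.extended θ N.sources).Arc a.1 a.2)
    (hneg : (N.extended θ N.sources).cycleCost γ.nodes < 0) : N.ThroughSuperSource γ := by
  obtain ⟨hne, -, hmem, -⟩ := cycleArcs_of_cycleCost_neg harc hneg
  exact ⟨_, (isSourceSinkPath_of_cycleCost_neg harc hneg).head_mem, (hmem _).2 (Or.inl rfl)⟩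

theorem mem_pathArcs_sourceSinkPath_iff
    (harc : ∀ a ∈ cycleArcs γ.nodes, (N.extended θ N.sources).Arc a.1 a.2)
    (hneg : (N.extended θ N.sources).cycleCost γ.nodes < 0) (v w : V) :
    (v, w) ∈ pathArcs (N.sourceSinkPath γ) ↔ (some v, some w) ∈ cycleArcs γ.nodes := by
  obtain ⟨hne, -, hmem, -⟩ := cycleArcs_of_cycleCost_neg harc hneg
  rw [hmem]
  simp

theorem pathTransit_sourceSinkPath
    (harc : ∀ a ∈ cycleArcs γ.nodes, (N.extended θ N.sources).Arc a.1 a.2)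
    (hneg : (N.extended θ N.sources).cycleCost γ.nodes < 0) :
    N.pathTransit (N.sourceSinkPath γ) =
      (N.extended θ N.sources).cycleCost γ.nodes + θ := by
  obtain ⟨hne, -, hmem, hcost⟩ := cycleArcs_of_cycleCost_neg harc hneg
  have hp := isSourceSinkPath_of_cycleCost_neg harc hneg
  have h1 : (N.extended θ N.sources).transit none (some ((N.sourceSinkPath γ).head hne)) = 0 :=
    if_neg fun h => Finset.disjoint_left.1 N.disjoint hp.head_mem h.1
  have h2 : (N.extended θ N.sources).transit (some ((N.sourceSinkPath γ).getLast hne)) none = -θ :=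
    if_pos ⟨hp.last_mem, fun h => Finset.disjoint_left.1 N.disjoint h hp.last_mem⟩
  rw [hcost, h1, h2]
  ring

theorem temporallyRepeated_zero :
    N.temporallyRepeated (0 : Multiset (CycleFlow (N.extended θ N.sources))) =
      fun _ _ _ => 0 := by
  funext v w t; simp [temporallyRepeated]

theorem temporallyRepeated_cons (γ : CycleFlow (N.extended θ N.sources))
    (Γ : Multiset (CycleFlow (N.extended θ N.sources))) :
    N.temporallyRepeated (γ ::ₘ Γ) = fun v w t =>
      (N.pathRate θ (N.sourceSinkPath γ) γ.value v w t -
        N.pathRate θ (N.sourceSinkPath γ) γ.value w v (t - N.transit w v)) +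
      N.temporallyRepeated Γ v w t := by
  funext v w t; simp [temporallyRepeated]

/-- Cycles of negative cost in the extended network, traversed along original arcs, give a
temporally repeated flow whose amount is the negative of their total cost. -/
theorem temporallyRepeated_of_cycleCost_neg [Fintype V]
    (Γ : Multiset (CycleFlow (N.extended θ N.sources)))
    (h : ∀ γ ∈ Γ, (∀ a ∈ cycleArcs γ.nodes, (N.extended θ N.sources).Arc a.1 a.2) ∧
      (N.extended θ N.sources).cycleCost γ.nodes < 0) :
    N.IsFlowOverTime (N.temporallyRepeated Γ) ∧ N.HasTimeHorizon (N.temporallyRepeated Γ) θ ∧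
      N.amount (N.temporallyRepeated Γ) = -(N.extended θ N.sources).cost (totalFlow Γ) := by
  induction Γ using Multiset.induction with
  | empty =>
    rw [temporallyRepeated_zero, totalFlow_zero, ArcNet.cost_zero, amount_zero, neg_zero]
    exact ⟨N.isFlowOverTime_zero, fun _ _ _ _ _ => rfl, rfl⟩
  | cons γ Γ ih =>
    obtain ⟨h1, h2, h3⟩ := ih fun δ hδ => h δ (Multiset.mem_cons_of_mem hδ)
    obtain ⟨harc, hneg⟩ := h γ (Multiset.mem_cons_self _ _)
    have hp := isSourceSinkPath_of_cycleCost_neg harc hneg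
    have hlen := pathTransit_sourceSinkPath harc hneg
    have hflow := hp.isFlowOverTime θ γ.value
    rw [temporallyRepeated_cons, totalFlow_cons, ArcNet.cost_add, γ.cost_flow,
      amount_add hflow h1, h3, hp.amount_eq (by linarith), hlen]
    refine ⟨hflow.add h1, fun v w hvw t ht => ?_, by ring⟩
    have h4 := hp.hasTimeHorizon θ γ.value v w hvw t ht
    simp only at h4
    simp only [h4, h2 v w hvw t ht, add_zero]

/-- A temporally repeated flow uses each arc at most at the rate of the underlying static flow. -/
theorem isFeasibleOverTime_temporallyRepeated [Fintype V]
    {Γ : Multiset (CycleFlow (N.extended θ N.sources))}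
    {y : Option V → Option V → ℝ} (hΓ : IsStandardChainDecomposition Γ y)
    (hy : (N.extended θ N.sources).IsCirculation y) (hf : (N.extended θ N.sources).IsFeasible y)
    (hneg : ∀ γ ∈ Γ, (N.extended θ N.sources).cycleCost γ.nodes < 0) :
    N.IsFeasibleOverTime (N.temporallyRepeated Γ) := by
  have harc : ∀ γ ∈ Γ, ∀ a ∈ cycleArcs γ.nodes, (N.extended θ N.sources).Arc a.1 a.2 :=
    fun γ hγ a ha => hΓ.arc hf hγ ha
  rintro v w (hvw | hvw) t
  · have h1 : N.temporallyRepeated Γ v w t ≤ y (some v) (some w) := by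
      rw [← hΓ.1, temporallyRepeated]
      refine Multiset.sum_map_le_sum_map _ _ fun γ hγ => ?_
      have hp := isSourceSinkPath_of_cycleCost_neg (harc γ hγ) (hneg γ hγ)
      refine (hp.rate_le_of_arc γ.value_pos.le hvw t).trans (le_of_eq ?_)
      have hnn : 0 ≤ y (some v) (some w) := hf.nonneg hy.skew hvw
      rw [hΓ.flow_eq hy.skew hγ hnn]
      have := mem_pathArcs_sourceSinkPath_iff (harc γ hγ) (hneg γ hγ) v w
      split_ifs <;> tauto
    exact (EReal.coe_le_coe_iff.2 h1).trans (hf (some v) (some w) (Or.inl hvw))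
  · have h1 : N.temporallyRepeated Γ v w t ≤ 0 := by
      rw [temporallyRepeated]
      refine Multiset.sum_induction (· ≤ 0) _ (fun a b ha hb => add_nonpos ha hb) le_rfl ?_
      intro r hr
      obtain ⟨γ, hγ, rfl⟩ := Multiset.mem_map.1 hr
      have hp := isSourceSinkPath_of_cycleCost_neg (harc γ hγ) (hneg γ hγ)
      exact hp.rate_nonpos_of_arc_symm γ.value_pos.le hvw t
    rw [N.cap_rev w v hvw]
    exact EReal.coe_le_coe_iff.2 h1

/-! ### Cycles of infinite capacity -/

/-- No cycle consists of arcs at the super-source only, because no source is a sink. -/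
theorem exists_cap_ne_top (hcap : ∀ v w, N.Arc v w → N.cap v w ≠ ⊤)
    {c : List (Option V)} (hne : c ≠ []) (hnd : c.Nodup)
    (harc : ∀ a ∈ cycleArcs c, (N.extended θ N.sources).Arc a.1 a.2) :
    ∃ a ∈ cycleArcs c, (N.extended θ N.sources).cap a.1 a.2 ≠ ⊤ := by
  by_contra! htop
  have hsucc : ∀ u ∈ c, (u, c.formPerm u) ∈ cycleArcs c ∧ c.formPerm u ∈ c := fun u hu =>
    ⟨(mem_cycleArcs_iff hnd).2 ⟨hu, rfl⟩, List.formPerm_apply_mem_of_mem hu⟩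
  have hsome : ∀ v w, (some v, some w) ∉ cycleArcs c := fun v w h =>
    hcap v w (harc _ h) (htop _ h)
  have hnone : none ∉ c := by
    intro h
    obtain ⟨h1, h2⟩ := hsucc none h
    rcases hs : c.formPerm none with _ | s
    · rw [hs] at h1
      exact harc _ h1
    · rw [hs] at h1 h2
      obtain ⟨h3, -⟩ := hsucc _ h2
      rcases ht : c.formPerm (some s) with _ | t
      · rw [ht] at h3
        exact Finset.disjoint_left.1 N.disjoint (harc _ h1).1 (harc _ h3).1
      · rw [ht] at h3
        exact hsome _ _ h3
  obtain ⟨u, hu⟩ := List.exists_mem_of_ne_nil c hne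
  obtain ⟨h1, h2⟩ := hsucc u hu
  rcases u with _ | v
  · exact hnone hu
  rcases hw : c.formPerm (some v) with _ | w
  · exact hnone (hw ▸ h2)
  · rw [hw] at h1
    exact hsome _ _ h1

/-- If flow could be sent without bound along a cycle of negative cost, then the temporally repeated
flows along its source-sink path would send arbitrarily large amounts. -/
theorem cycleCost_nonneg_of_bddAbove [Fintype V] (hbdd : BddAbove (N.amounts θ))
    {c : List (Option V)} (hne : c ≠ []) (hnd : c.Nodup)
    (hc : ∀ a ∈ cycleArcs c, (N.extended θ N.sources).Arc a.1 a.2 ∧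
      (N.extended θ N.sources).cap a.1 a.2 = ⊤) :
    0 ≤ (N.extended θ N.sources).cycleCost c := by
  by_contra! hneg
  obtain ⟨B, hB⟩ := hbdd
  set M := N.extended θ N.sources
  -- the value for which the amount is `|B| + 1`
  have hval : 0 < (|B| + 1) / -M.cycleCost c := by
    have := abs_nonneg B
    exact div_pos (by linarith) (by linarith)
  let γ : CycleFlow M := ⟨c, hne, hnd, fun a ha => Or.inl (hc a ha).1, _, hval⟩
  have hopp : ∀ v w, (v, w) ∈ cycleArcs c → (w, v) ∉ cycleArcs c := fun v w h h' =>
    M.asymm v w (hc _ h).1 (hc _ h').1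
  have hΓ : IsStandardChainDecomposition {γ} γ.flow := by
    refine ⟨fun v w => by simp, fun δ hδ a ha => ?_⟩
    rw [Multiset.mem_singleton] at hδ
    subst hδ
    rw [CycleFlow.flow, if_pos ha, if_neg (hopp _ _ ha), sub_zero]
    exact hval
  have hf : M.IsFeasible γ.flow := by
    intro v w hvw
    by_cases ha : (v, w) ∈ cycleArcs c
    · rw [(hc _ ha).2]
      exact le_top
    · refine le_trans (EReal.coe_le_coe_iff.2 ?_) (ArcNet.cap_nonneg hvw)
      rw [CycleFlow.flow, if_neg ha]
      split_ifs
      · linarith [γ.value_pos]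
      · simp
  have hfeas := isFeasibleOverTime_temporallyRepeated hΓ γ.isCirculation_flow hf fun δ hδ => by
    rw [Multiset.mem_singleton] at hδ
    subst hδ
    exact hneg
  obtain ⟨h1, h2, h3⟩ := temporallyRepeated_of_cycleCost_neg {γ} fun δ hδ => by
    rw [Multiset.mem_singleton] at hδ
    subst hδ
    exact ⟨fun a ha => (hc a ha).1, hneg⟩
  have h4 := hB ⟨_, h1, hfeas, h2, h3⟩
  rw [hΓ.totalFlow_eq, γ.cost_flow] at h4
  have h5 : -(γ.value * M.cycleCost γ.nodes) = |B| + 1 := by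
    change -((|B| + 1) / -M.cycleCost c * M.cycleCost c) = |B| + 1
    rw [div_neg, neg_mul, neg_neg, div_mul_cancel₀ _ hneg.ne]
  rw [h5] at h4
  linarith [le_abs_self B]

end extended

end Network

end FlowOverTime

end

theorem mainTheorem4 {V : Type*} [Fintype V] [DecidableEq V] (N : FlowOverTime.Network V)
    (θ : ℝ) (hθ : 0 ≤ θ) :
    ((∀ v w, N.Arc v w → N.cap v w ≠ ⊤) →
      ∃ x, (N.extended θ N.sources).IsMinCostCirculation x) ∧
    ((∃ x, (N.extended θ N.sources).IsMinCostCirculation x) ↔ BddAbove (N.amounts θ)) ∧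
    ∀ x, (N.extended θ N.sources).IsMinCostCirculation x →
      IsGreatest (N.amounts θ) (-(N.extended θ N.sources).cost x) ∧
      ∃ (y : Option V → Option V → ℝ)
        (Γ : Multiset (FlowOverTime.CycleFlow (N.extended θ N.sources))),
        (N.extended θ N.sources).IsMinCostCirculation y ∧
        FlowOverTime.IsStandardChainDecomposition Γ y ∧
        (∀ γ ∈ Γ, N.ThroughSuperSource γ) ∧
        N.IsFlowOverTime (N.temporallyRepeated Γ) ∧
        N.IsFeasibleOverTime (N.temporallyRepeated Γ) ∧
        N.HasTimeHorizon (N.temporallyRepeated Γ) θ ∧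
        N.amount (N.temporallyRepeated Γ) = -(N.extended θ N.sources).cost x := by
  have hupper : ∀ x, (N.extended θ N.sources).IsMinCostCirculation x →
      -(N.extended θ N.sources).cost x ∈ upperBounds (N.amounts θ) := by
    rintro x hx F ⟨f, hf, hfeas, hhor, rfl⟩
    exact N.amount_le hx hf hfeas hhor
  refine ⟨fun hcap => ?_, ⟨fun ⟨x, hx⟩ => ⟨_, hupper x hx⟩, fun hbdd => ?_⟩, fun x hx => ?_⟩
  · refine FlowOverTime.ArcNet.exists_isMinCostCirculation fun c hne hnd hc => ?_
    obtain ⟨a, ha, htop⟩ := FlowOverTime.Network.exists_cap_ne_top hcap hne hnd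
      fun a ha => (hc a ha).1
    exact absurd (hc a ha).2 htop
  · exact FlowOverTime.ArcNet.exists_isMinCostCirculation fun c hne hnd hc =>
      FlowOverTime.Network.cycleCost_nonneg_of_bddAbove hbdd hne hnd hc
  · obtain ⟨Γ, hmin, hΓ, hneg⟩ := hx.exists_negative_decomposition
    have harc := fun γ (hγ : γ ∈ Γ) a (ha : a ∈ FlowOverTime.cycleArcs γ.nodes) =>
      hΓ.arc hmin.2.1 hγ (v := a.1) (w := a.2) ha
    have hfeas := FlowOverTime.Network.isFeasibleOverTime_temporallyRepeated hΓ hmin.1 hmin.2.1 hneg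
    obtain ⟨hflow, hhor, hamount⟩ := FlowOverTime.Network.temporallyRepeated_of_cycleCost_neg Γ
      fun γ hγ => ⟨harc γ hγ, hneg γ hγ⟩
    have hcost : (N.extended θ N.sources).cost (FlowOverTime.totalFlow Γ) =
        (N.extended θ N.sources).cost x :=
      le_antisymm (hmin.2.2 _ hx.1 hx.2.1) (hx.2.2 _ hmin.1 hmin.2.1)
    rw [hcost] at hamount
    exact ⟨⟨⟨_, hflow, hfeas, hhor, hamount⟩, hupper x hx⟩, _, Γ, hmin, hΓ,
      fun γ hγ => FlowOverTime.Network.throughSuperSource_of_cycleCost_neg (harc γ hγ) (hneg γ hγ),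
      hflow, hfeas, hhor, hamount⟩
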